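/- For positive integers $n,m$ let $H_{n,m}=\sum_{k=1}^{n}\frac1{k^m}$ and $H_n=H_{n,1}$. Let $B_0,B_1,B_2,\ldots$ be the Bernoulli numbers, given by $B_0=1$ and $\sum_{k=0}^{n}\binom{n+1}{k}B_k=0$ for $n\ge 1$, and for a prime $p>2$ let $q_p(2)=\frac{2^{p-1}-1}{p}$ be the Fermat quotient. For rational numbers $x,y$ and a prime power $p^e$ with $e\ge1$, $x\equiv y\pmod{p^e}$ means that $x-y=p^e c$ for some rational number $c$ whose denominator in lowest terms is not divisible by $p$. **Theorem 1.1.** Let $p>5$ be a prime. Then $$\sum_{k=1}^{p-1}\frac{2^kH_k}{k}\equiv -q_p(2)^2+\frac23\,p\,q_p(2)^3+\frac{p}{12}B_{p-3}\pmod{p^2},$$ $$\sum_{k=1}^{p-1}\frac{2^kH_k}{k^2}\equiv -\frac13q_p(2)^3+\frac{23}{24}B_{p-3}\pmod{p},$$ $$\sum_{k=1}^{p-1}\frac{H_k}{k^2\cdot 2^k}\equiv \frac58B_{p-3}\pmod{p},$$ $$\sum_{k=1}^{p-1}\frac{2^kH_k^2}{k}\equiv -\frac13q_p(2)^3+\frac{11}{24}B_{p-3}\pmod{p},$$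 $$\sum_{k=1}^{p-1}\frac{H_k^2}{k\cdot 2^k}\equiv \frac78B_{p-3}\pmod{p},$$ $$\sum_{k=1}^{p-1}\frac{2^kH_{k,2}}{k}\equiv -\frac13q_p(2)^3-\frac{25}{24}B_{p-3}\pmod{p}.$$ -/

import Mathlib

/-- The harmonic number of order `m`: `H_{n,m} = ∑_{k=1}^n 1 / k ^ m`.
For `m = 1` this is Mathlib's `harmonic n`. -/
def harmonicOrd (n m : ℕ) : ℚ := ∑ k ∈ Finset.Icc 1 n, 1 / (k : ℚ) ^ m

/-- The Fermat quotient `q_p(a) = (a ^ (p - 1) - 1) / p`, as a rational number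
(for `p` a prime not dividing `a` it is an integer). -/
def fermatQuotient (p : ℕ) (a : ℤ) : ℚ := ((a : ℚ) ^ (p - 1) - 1) / (p : ℚ)

/-- Congruence of rational numbers modulo `m`: the difference `x - y` is `m` times a rational
number whose denominator (in lowest terms) is prime to `m`. For `m = p ^ e` with `p` prime and
`e ≥ 1` this says `x - y ∈ p ^ e ℤ_(p)`. -/
def RatModEq (m : ℕ) (x y : ℚ) : Prop := ∃ c : ℚ, c.den.Coprime m ∧ x - y = (m : ℚ) * c

/-! Write q for the Fermat quotient, H for harmonic numbers, κ = ∑ H_{k-1}/k^2 over 0 < k < p, and a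
= ∑ (-1)^k/k^3. Everything rests on the substitution x ↦ 1 - x in ∑ f(m) x^m. Since (-1)^k C(p-1,k)
≡ 1 mod p, it has simple dual coefficients mod p: 1/m is self-dual, 1/m^2 goes to -H_{k-1}/k, 1/m^3
to e₂/k (e₂ being the elementary symmetric function of the 1/j, j < k), and H_{m-1}/m^2 to
H_{k-1,2}/k up to the constant term. The substitution exchanges 2 and -1, and at -1 the reversal k ↦
p - k evaluates the sums.

Modulo p, duality and reversal express the weight three harmonic sums at 2 through κ and a. The
remaining sums ∑ 2^k/k^2 and ∑ 2^k/k^3 come from multiplying ∑ 2^k/k by itself and by ∑ 2^k/k^2: as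
2^p = 2 in `ZMod p`, exponents wrap around, and partial fractions turn the convolutions back into
harmonic sums. The inputs are ∑ 2^k/k ≡ -2q, κ ≡ B_{p-3} (`sum_hBelow_div_sq_eq_bernoulli`) and 2a ≡
-κ (`two_mul_sum_neg_one_pow_div_cube`). Sums with 2^k in the denominator reduce to these by k ↦ p -
k.

The congruence modulo p^2 uses the duality of 1/m over ℚ, where (-1)^k C(p-1,k) = ∏_{j ≤ k} (1 -
p/j) is expanded in powers of p. At x = 2 and x = -1 this gives two relations modulo p^3.
Eliminating ∑ 2^k/k leaves p ∑ 2^k H_k/k in terms of q, power sums over the full and half ranges,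
and weight three sums. The decisive half-range term is H_{(p-1)/2} modulo p^3
(`hBelow_one_half_relation`). Dividing by p gives the result. -/

/-- The power sum `∑_{0 < j < k} 1 / j ^ m` in a field (for `m ≥ 1`). -/
def hBelow (K : Type*) [Field K] (m k : ℕ) : K := ∑ j ∈ Finset.range k, 1 / (j : K) ^ m

/-- The second elementary symmetric function of `1 / j`, `0 < j < k`. -/
def eBelow₂ (K : Type*) [Field K] (k : ℕ) : K := ∑ j ∈ Finset.range k, hBelow K 1 j / j

/-- The third elementary symmetric function of `1 / j`, `0 < j < k`. -/
def eBelow₃ (K : Type*) [Field K] (k : ℕ) : K := ∑ j ∈ Finset.range k, eBelow₂ K j / j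

/-! ### Binomial duality under x ↦ 1 - x over a field -/

section Field

variable {K : Type*} [Field K]

lemma hBelow_succ (m k : ℕ) : hBelow K m (k + 1) = hBelow K m k + 1 / (k : K) ^ m :=
  Finset.sum_range_succ _ _

lemma hBelow_zero (m : ℕ) : hBelow K m 0 = 0 := by simp [hBelow]

lemma eBelow₂_succ (k : ℕ) : eBelow₂ K (k + 1) = eBelow₂ K k + hBelow K 1 k / k :=
  Finset.sum_range_succ _ _

lemma eBelow₃_succ (k : ℕ) : eBelow₃ K (k + 1) = eBelow₃ K k + eBelow₂ K k / k :=
  Finset.sum_range_succ _ _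

lemma two_mul_eBelow₂ (k : ℕ) : 2 * eBelow₂ K k = hBelow K 1 k ^ 2 - hBelow K 2 k := by
  induction k with
  | zero => simp [eBelow₂, hBelow]
  | succ k ih =>
    rw [eBelow₂_succ, hBelow_succ, hBelow_succ]
    simp only [div_eq_mul_inv, pow_one, ← inv_pow]
    linear_combination ih

lemma six_mul_eBelow₃ (k : ℕ) : 6 * eBelow₃ K k =
    hBelow K 1 k ^ 3 - 3 * hBelow K 1 k * hBelow K 2 k + 2 * hBelow K 3 k := by
  induction k with
  | zero => simp [eBelow₃, hBelow]
  | succ k ih =>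
    rw [eBelow₃_succ, hBelow_succ, hBelow_succ, hBelow_succ]
    have h := two_mul_eBelow₂ (K := K) k
    simp only [div_eq_mul_inv, pow_one, ← inv_pow]
    linear_combination ih + 3 * (k : K)⁻¹ * h

/-- The coefficients of `∑_{m < N} f m (1 - x) ^ m`. -/
def binomDual (N : ℕ) (f : ℕ → K) (k : ℕ) : K :=
  (-1) ^ k * ∑ m ∈ Finset.range N, (m.choose k : K) * f m

lemma sum_mul_one_sub_pow (N : ℕ) (f : ℕ → K) (x : K) :
    ∑ m ∈ Finset.range N, f m * (1 - x) ^ m =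
      ∑ k ∈ Finset.range N, binomDual N f k * x ^ k := by
  simp only [binomDual, Finset.mul_sum, Finset.sum_mul]
  rw [Finset.sum_comm]
  refine Finset.sum_congr rfl fun m hm => ?_
  rw [sub_eq_add_neg, add_comm, add_pow, Finset.mul_sum]
  rw [Finset.mem_range] at hm
  refine (Finset.sum_subset (by simpa using hm) fun k _ hk => ?_).trans
    (Finset.sum_congr rfl fun k _ => ?_)
  · simp only [Finset.mem_range, not_lt] at hk
    rw [Nat.choose_eq_zero_of_lt (by omega)]; simp
  · rw [neg_pow]; ring

lemma binomDual_zero (N : ℕ) (f : ℕ → K) : binomDual N f 0 = ∑ m ∈ Finset.range N, f m := by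
  simp [binomDual]

lemma choose_div_eq {m k : ℕ} (hm : (m : K) ≠ 0) (hk : (k : K) ≠ 0) :
    (m.choose k : K) / m = ((m - 1).choose (k - 1) : K) / k := by
  obtain ⟨m, rfl⟩ : ∃ m', m = m' + 1 := ⟨m - 1, by
    have : m ≠ 0 := fun h => hm (by simp [h]); omega⟩
  obtain ⟨k, rfl⟩ : ∃ k', k = k' + 1 := ⟨k - 1, by
    have : k ≠ 0 := fun h => hk (by simp [h]); omega⟩
  rw [div_eq_div_iff hm hk]
  have := Nat.add_one_mul_choose_eq m k
  simp only [Nat.add_sub_cancel]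
  rw [← Nat.cast_mul, ← Nat.cast_mul, ← this, mul_comm]

lemma alternating_sum_choose {m k : ℕ} (hm : m ≠ 0) (hk : k ≠ 0) :
    ∑ j ∈ Finset.range k, (-1 : K) ^ j * (m.choose j : K) =
      (-1) ^ (k - 1) * ((m - 1).choose (k - 1) : K) := by
  obtain ⟨m, rfl⟩ : ∃ m', m = m' + 1 := ⟨m - 1, by omega⟩
  obtain ⟨k, rfl⟩ : ∃ k', k = k' + 1 := ⟨k - 1, by omega⟩
  simp only [Nat.add_sub_cancel]
  clear hm hk
  induction k with
  | zero => simp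
  | succ k ih =>
    rw [Finset.sum_range_succ, ih, Nat.choose_succ_succ]
    push_cast; ring

/-- Dividing `f m` by `m` turns the dual coefficients into partial sums. -/
lemma binomDual_div {N : ℕ} (hN : ∀ m, 0 < m → m < N → (m : K) ≠ 0) {f : ℕ → K} (hf : f 0 = 0)
    {k : ℕ} (hk : 0 < k) (hkN : k < N) :
    binomDual N (fun m => f m / m) k =
      -(∑ j ∈ Finset.range k, binomDual N f j) / k := by
  simp only [binomDual, Finset.mul_sum]
  rw [Finset.sum_comm, ← Finset.sum_neg_distrib, Finset.sum_div]
  refine Finset.sum_congr rfl fun m hm => ?_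
  rcases Nat.eq_zero_or_pos m with rfl | hm0
  · simp [hf]
  have hm' := hN m hm0 (by simpa using hm)
  have hk' := hN k hk hkN
  -- The alternating partial row sum of C(m,j) is, up to sign, C(m-1,k-1), and absorption turns this
  -- into k C(m,k)/m: summing dual coefficients over j < k is the same as dividing by m.
  have h1 := alternating_sum_choose (K := K) hm0.ne' hk.ne'
  have h2 := choose_div_eq (K := K) hm' hk'
  simp only [← mul_assoc, ← Finset.sum_mul]
  rw [h1]
  obtain ⟨k, rfl⟩ : ∃ k', k = k' + 1 := ⟨k - 1, by omega⟩
  simp only [Nat.add_sub_cancel] at *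
  calc _ = (-1) ^ (k + 1) * f m * ((m.choose (k + 1) : K) / m) := by ring
    _ = _ := by rw [h2]; ring

lemma sum_choose_pred (N : ℕ) {k : ℕ} (hk : 0 < k) (hN : 0 < N) (j : ℕ) (hj : j < N) :
    ∑ m ∈ Finset.Ico (j + 1) N, ((m - 1).choose (k - 1) : K) =
      ((N - 1).choose k : K) - (j.choose k : K) := by
  obtain ⟨k, rfl⟩ : ∃ k', k = k' + 1 := ⟨k - 1, by omega⟩
  obtain ⟨N, rfl⟩ : ∃ k', N = k' + 1 := ⟨N - 1, by omega⟩
  have hj' : j ≤ N := by omega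
  clear hj hN hk
  induction N, hj' using Nat.le_induction with
  | base => simp
  | succ n hn ih =>
    rw [Finset.sum_Ico_succ_top (by omega), ih]
    simp [Nat.choose_succ_succ]; ring

/-- Absorption C(m,k)/m = C(m-1,k-1)/k reduces the sum to the hockey-stick identity. The case k = 0
is excluded: there the dual coefficient is a harmonic number. -/
lemma binomDual_inv {N : ℕ} (hN : ∀ m, 0 < m → m < N → (m : K) ≠ 0)
    {k : ℕ} (hk : 0 < k) (hkN : k < N) :
    binomDual N (fun m => 1 / (m : K)) k = (-1) ^ k * ((N - 1).choose k : K) / k := by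
  have h := sum_choose_pred (K := K) N hk (by omega) 0 (by omega)
  rw [Nat.choose_eq_zero_of_lt hk, Nat.cast_zero, sub_zero] at h
  rw [binomDual, ← h, mul_div_assoc, Finset.sum_div, Finset.range_eq_Ico,
    Finset.sum_eq_sum_Ico_succ_bot (by omega)]
  simp only [Nat.cast_zero, div_zero, mul_zero, zero_add]
  congr 1
  refine Finset.sum_congr rfl fun m hm => ?_
  rw [Finset.mem_Ico] at hm
  rw [← choose_div_eq (hN m (by omega) hm.2) (hN k hk hkN)]; ring

/-- Exchanging the two summations leaves, for each j, a tail hockey-stick sum equal to C(N-1,k) -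
C(j,k). The first part produces the harmonic number, the second is `binomDual_inv` again. -/
lemma binomDual_hBelow_div {N : ℕ} (hN : ∀ m, 0 < m → m < N → (m : K) ≠ 0)
    {k : ℕ} (hk : 0 < k) (hkN : k < N) :
    binomDual N (fun m => hBelow K 1 m / m) k =
      (-1) ^ k * ((N - 1).choose k : K) / k * (hBelow K 1 N - 1 / k) := by
  have hk0 := hN k hk hkN
  have key : ∑ m ∈ Finset.range N, (m.choose k : K) * (hBelow K 1 m / m) =
      ∑ j ∈ Finset.range N, 1 / (j : K) * ((((N - 1).choose k : K) - j.choose k) / k) := by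
    have h1 : ∀ m ∈ Finset.range N, (m.choose k : K) * (hBelow K 1 m / m) =
        ∑ j ∈ Finset.range N, if j < m then 1 / (j : K) * (((m - 1).choose (k - 1) : K) / k)
          else 0 := by
      intro m hm
      rw [Finset.mem_range] at hm
      rcases Nat.eq_zero_or_pos m with rfl | hm0
      · simp [hBelow_zero]
      rw [← Finset.sum_filter, ← Finset.sum_mul,
        ← choose_div_eq (hN m hm0 hm) hk0]
      have : Finset.filter (fun j => j < m) (Finset.range N) = Finset.range m := by
        ext j; simp; omega
      rw [this, hBelow]; simp only [pow_one]; ring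
    rw [Finset.sum_congr rfl h1, Finset.sum_comm]
    refine Finset.sum_congr rfl fun j hj => ?_
    rw [Finset.mem_range] at hj
    rw [← sum_choose_pred N hk (by omega) j hj, Finset.sum_div, Finset.mul_sum, ← Finset.sum_filter]
    refine Finset.sum_congr ?_ fun _ _ => rfl
    ext m; simp; omega
  have h2 := binomDual_inv (K := K) hN hk hkN
  rw [binomDual] at h2 ⊢
  have h3 : ∑ j ∈ Finset.range N, 1 / (j : K) * ((((N - 1).choose k : K) - j.choose k) / k) =
      ((N - 1).choose k : K) / k * hBelow K 1 N -
        (∑ j ∈ Finset.range N, (j.choose k : K) * (1 / (j : K))) / k := by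
    rw [hBelow, Finset.mul_sum, Finset.sum_div, ← Finset.sum_sub_distrib]
    refine Finset.sum_congr rfl fun j _ => ?_
    ring
  rw [key, h3]
  linear_combination (-1 / (k : K)) * h2

/-- Pairs are grouped by j + k modulo p: the true sum of indices is m when j ≤ m and m + p
otherwise. -/
lemma sum_range_sum_range_wrap {A : Type*} [AddCommMonoid A] (p : ℕ) (F : ℕ → ℕ → A) :
    ∑ j ∈ Finset.range p, ∑ k ∈ Finset.range p, F j k =
      ∑ m ∈ Finset.range p, (∑ j ∈ Finset.range (m + 1), F j (m - j) +
        ∑ j ∈ Finset.Ico (m + 1) p, F j (m + p - j)) := by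
  have h : ∀ j ∈ Finset.range p, ∑ k ∈ Finset.range p, F j k =
      ∑ m ∈ Finset.range p, if j < m + 1 then F j (m - j) else F j (m + p - j) := by
    intro j hj
    rw [Finset.mem_range] at hj
    rw [Finset.sum_ite]
    have e1 : Finset.filter (fun m => j < m + 1) (Finset.range p) = Finset.Ico j p := by
      ext; simp; omega
    have e2 : Finset.filter (fun m => ¬ j < m + 1) (Finset.range p) = Finset.range j := by
      ext; simp; omega
    rw [e1, e2, Finset.sum_Ico_eq_sum_range,
      ← Finset.sum_range_add_sum_Ico (fun k => F j k) (show p - j ≤ p by omega),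
      Finset.sum_Ico_eq_sum_range]
    have e3 : p - (p - j) = j := by omega
    rw [e3]
    refine congrArg₂ _ (Finset.sum_congr rfl fun k _ => ?_) (Finset.sum_congr rfl fun k _ => ?_)
    · congr 1; omega
    · congr 1; omega
  rw [Finset.sum_congr rfl h, Finset.sum_comm]
  refine Finset.sum_congr rfl fun m hm => ?_
  rw [Finset.mem_range] at hm
  rw [Finset.sum_ite]
  congr 1
  · refine Finset.sum_congr ?_ fun _ _ => rfl
    ext; simp; omega
  · refine Finset.sum_congr ?_ fun _ _ => rfl
    ext; simp; omega

lemma sum_range_reverse {p : ℕ} {f : ℕ → K} (h : f 0 = f p) :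
    ∑ k ∈ Finset.range p, f k = ∑ k ∈ Finset.range p, f (p - k) := by
  have := Finset.sum_flip f (n := p)
  rw [Finset.sum_range_succ, Finset.sum_range_succ, Nat.sub_self, h] at this
  exact (add_right_cancel this).symm

end Field

/-! ### p-integral rationals and their residues -/

section Integral

/-- The subring of `ℚ` of `p`-integral rational numbers. -/
def pIntegers (p : ℕ) [Fact p.Prime] : Subring ℚ where
  carrier := {x | (x.den : ZMod p) ≠ 0}
  mul_mem' {x y} hx hy := by
    obtain ⟨c, hc⟩ := Rat.mul_den_dvd x y
    have h : ((x.den * y.den : ℕ) : ZMod p) ≠ 0 := by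
      rw [Nat.cast_mul]; exact mul_ne_zero hx hy
    rw [hc, Nat.cast_mul] at h
    exact left_ne_zero_of_mul h
  one_mem' := by simp
  add_mem' {x y} hx hy := by
    obtain ⟨c, hc⟩ := Rat.add_den_dvd x y
    have h : ((x.den * y.den : ℕ) : ZMod p) ≠ 0 := by
      rw [Nat.cast_mul]; exact mul_ne_zero hx hy
    rw [hc, Nat.cast_mul] at h
    exact left_ne_zero_of_mul h
  zero_mem' := by simp
  neg_mem' {x} hx := by simpa using hx

variable {p : ℕ} [Fact p.Prime]

lemma mem_pIntegers {x : ℚ} : x ∈ pIntegers p ↔ (x.den : ZMod p) ≠ 0 := Iff.rfl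

lemma natCast_zmod_ne_zero {k : ℕ} (h0 : 0 < k) (h : k < p) : (k : ZMod p) ≠ 0 := by
  rw [Ne, ZMod.natCast_eq_zero_iff]
  exact Nat.not_dvd_of_pos_of_lt h0 h

lemma inv_natCast_mem {k : ℕ} (h : k < p) : (k : ℚ)⁻¹ ∈ pIntegers p := by
  rcases Nat.eq_zero_or_pos k with rfl | h0
  · simp [zero_mem]
  rw [mem_pIntegers, Rat.inv_natCast_den_of_pos h0]
  exact natCast_zmod_ne_zero h0 h

/-- `x` is `p`-integral with residue `y`. -/
def Reduces (p : ℕ) [Fact p.Prime] (x : ℚ) (y : ZMod p) : Prop :=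
  x ∈ pIntegers p ∧ (x : ZMod p) = y

namespace Reduces

variable {x x' : ℚ} {y y' : ZMod p}

lemma of_mem (h : x ∈ pIntegers p) : Reduces p x x := ⟨h, rfl⟩

lemma add (h : Reduces p x y) (h' : Reduces p x' y') : Reduces p (x + x') (y + y') :=
  ⟨add_mem h.1 h'.1, by rw [Rat.cast_add_of_ne_zero h.1 h'.1, h.2, h'.2]⟩

lemma sub (h : Reduces p x y) (h' : Reduces p x' y') : Reduces p (x - x') (y - y') :=
  ⟨sub_mem h.1 h'.1, by rw [Rat.cast_sub_of_ne_zero h.1 h'.1, h.2, h'.2]⟩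

lemma mul (h : Reduces p x y) (h' : Reduces p x' y') : Reduces p (x * x') (y * y') :=
  ⟨mul_mem h.1 h'.1, by rw [Rat.cast_mul_of_ne_zero h.1 h'.1, h.2, h'.2]⟩

lemma neg (h : Reduces p x y) : Reduces p (-x) (-y) :=
  ⟨neg_mem h.1, by rw [Rat.cast_neg, h.2]⟩

lemma natCast (n : ℕ) : Reduces p n n := ⟨natCast_mem _ n, Rat.cast_natCast n⟩

lemma one : Reduces p 1 1 := by simpa using natCast (p := p) 1

lemma zero : Reduces p 0 0 := by simpa using natCast (p := p) 0

lemma ofNat (n : ℕ) [n.AtLeastTwo] : Reduces p (OfNat.ofNat n) (OfNat.ofNat n) := by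
  have := natCast (p := p) (OfNat.ofNat n)
  rwa [Nat.cast_ofNat, Nat.cast_ofNat] at this

lemma pow (h : Reduces p x y) (n : ℕ) : Reduces p (x ^ n) (y ^ n) := by
  induction n with
  | zero => simpa using one
  | succ n ih => simpa [pow_succ] using ih.mul h

lemma inv_natCast {k : ℕ} (h : k < p) : Reduces p (k : ℚ)⁻¹ (k : ZMod p)⁻¹ := by
  refine ⟨inv_natCast_mem h, ?_⟩
  rcases Nat.eq_zero_or_pos k with rfl | h0
  · simp
  have hk := natCast_zmod_ne_zero h0 h
  have := (of_mem (inv_natCast_mem h)).mul (natCast k)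
  rw [inv_mul_cancel₀ (by exact_mod_cast h0.ne')] at this
  exact eq_inv_of_mul_eq_one_left (by rw [← this.2, one.2])

lemma div_natCast {k : ℕ} (h : Reduces p x y) (hk : k < p) : Reduces p (x / k) (y / k) := by
  rw [div_eq_mul_inv, div_eq_mul_inv]
  exact h.mul (inv_natCast hk)

lemma div_natCast_pow {k : ℕ} (h : Reduces p x y) (hk : k < p) (m : ℕ) :
    Reduces p (x / (k : ℚ) ^ m) (y / (k : ZMod p) ^ m) := by
  rw [div_eq_mul_inv, div_eq_mul_inv, ← inv_pow, ← inv_pow]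
  exact h.mul ((inv_natCast hk).pow m)

lemma sum {ι : Type*} {s : Finset ι} {f : ι → ℚ} {g : ι → ZMod p}
    (h : ∀ i ∈ s, Reduces p (f i) (g i)) : Reduces p (∑ i ∈ s, f i) (∑ i ∈ s, g i) := by
  classical
  induction s using Finset.induction_on with
  | empty => simpa using zero
  | insert a s ha ih =>
    rw [Finset.sum_insert ha, Finset.sum_insert ha]
    exact (h a (by simp)).add (ih fun i hi => h i (by simp [hi]))

lemma hBelow (m : ℕ) {k : ℕ} (hk : k ≤ p) : Reduces p (hBelow ℚ m k) (hBelow (ZMod p) m k) :=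
  sum fun j hj => one.div_natCast_pow (by rw [Finset.mem_range] at hj; omega) m

lemma eBelow₂ {k : ℕ} (hk : k ≤ p) : Reduces p (eBelow₂ ℚ k) (eBelow₂ (ZMod p) k) :=
  sum fun j hj => by
    rw [Finset.mem_range] at hj
    exact (hBelow 1 (by omega)).div_natCast (by omega)

lemma eBelow₃ {k : ℕ} (hk : k ≤ p) : Reduces p (eBelow₃ ℚ k) (eBelow₃ (ZMod p) k) :=
  sum fun j hj => by
    rw [Finset.mem_range] at hj
    exact (eBelow₂ (by omega)).div_natCast (by omega)

lemma congr_right (h : Reduces p x y) (e : y = y') : Reduces p x y' := e ▸ h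

lemma exists_eq_mul (h : Reduces p x 0) : ∃ c ∈ pIntegers p, x = p * c := by
  obtain ⟨hx, hx0⟩ := h
  have hx' : (x.den : ZMod p) ≠ 0 := hx
  rw [Rat.cast_def, div_eq_zero_iff, or_iff_left hx', ZMod.intCast_zmod_eq_zero_iff_dvd] at hx0
  obtain ⟨d, hd⟩ := hx0
  have hc := mul_mem (intCast_mem (pIntegers p) d)
    (show (x.den : ℚ)⁻¹ ∈ pIntegers p by
      rw [mem_pIntegers, Rat.inv_natCast_den_of_pos x.den_pos]; exact hx)
  refine ⟨_, hc, ?_⟩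
  conv_lhs => rw [← Rat.num_div_den x, hd]
  push_cast; ring

end Reduces

lemma ratModEq_of_eq {e : ℕ} {x y c : ℚ} (hc : c ∈ pIntegers p) (h : x - y = (p : ℚ) ^ e * c) :
    RatModEq (p ^ e) x y := by
  refine ⟨c, ?_, by push_cast; exact h⟩
  rw [mem_pIntegers, Ne, ZMod.natCast_eq_zero_iff] at hc
  exact Nat.Coprime.pow_right _ ((Nat.Prime.coprime_iff_not_dvd Fact.out).2 hc).symm

end Integral

/-! ### Harmonic sums and their duals modulo p -/

section ZModSums

open Finset

variable {p : ℕ} [Fact p.Prime]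

lemma sum_range_zmod {A : Type*} [AddCommMonoid A] (f : ZMod p → A) :
    ∑ k ∈ range p, f (k : ZMod p) = ∑ x, f x := by
  refine sum_nbij' (fun k => (k : ZMod p)) ZMod.val (by simp)
    (fun x _ => by simpa using ZMod.val_lt x) (fun k hk => ?_) (fun x _ => ?_) (by simp)
  · exact ZMod.val_cast_of_lt (by simpa using hk)
  · exact ZMod.natCast_zmod_val x

lemma hBelow_zmod_self {m : ℕ} (h : m < p - 1) : hBelow (ZMod p) m p = 0 := by
  rw [hBelow, sum_range_zmod (fun x : ZMod p => 1 / x ^ m)]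
  simp only [one_div, ← inv_pow]
  rw [Fintype.sum_equiv (Equiv.inv (ZMod p)) (fun x => x⁻¹ ^ m) (fun x => x ^ m) (fun _ => rfl)]
  exact FiniteField.sum_pow_lt_card_sub_one _ m (by rwa [ZMod.card])

lemma natCast_sub_zmod {k : ℕ} (hk : k ≤ p) : ((p - k : ℕ) : ZMod p) = -k := by
  rw [Nat.cast_sub hk]; simp

lemma one_div_neg_pow {K : Type*} [Field K] (x : K) (m : ℕ) :
    1 / (-x) ^ m = (-1) ^ m * (1 / x ^ m) := by
  rw [one_div, one_div, ← inv_pow, inv_neg, neg_pow, inv_pow]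

/-- Because the full sum over 0 < j < p vanishes, the terms with j ≥ p - k determine the rest, and j
↦ p - j maps them to the first k. In terms of harmonic numbers, H_{p-1-k,m} ≡ -(-1)^m H_{k,m}. -/
lemma hBelow_zmod_reflect {m : ℕ} (hm : 0 < m) (h : m < p - 1) {k : ℕ} (hk : k < p) :
    hBelow (ZMod p) m (p - k) = -(-1) ^ m * hBelow (ZMod p) m (k + 1) := by
  induction k with
  | zero => rw [Nat.sub_zero, hBelow_zmod_self h]; simp [hBelow, hm.ne']
  | succ k ih =>
    have h1 := hBelow_succ (K := ZMod p) m (p - (k + 1))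
    rw [show p - (k + 1) + 1 = p - k by omega, ih (by omega), natCast_sub_zmod hk.le,
      one_div_neg_pow] at h1
    rw [hBelow_succ m (k + 1)]
    linear_combination -h1

lemma choose_pred_zmod {k : ℕ} (hk : k < p) :
    (-1) ^ k * ((p - 1).choose k : ZMod p) = 1 := by
  induction k with
  | zero => simp
  | succ k ih =>
    have h1 := Nat.choose_succ_succ (p - 1) k
    have h2 : p - 1 + 1 = p := by omega
    rw [Nat.succ_eq_add_one, h2] at h1
    have h3 : ((p.choose (k + 1) : ℕ) : ZMod p) = 0 :=
      (ZMod.natCast_eq_zero_iff _ _).2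
        ((Fact.out : p.Prime).dvd_choose_self (by omega) hk)
    rw [h1] at h3
    push_cast at h3
    rw [pow_succ]
    linear_combination ih (by omega) - (-1) ^ k * h3

lemma natCast_zmod_ne_zero' : ∀ m, 0 < m → m < p → (m : ZMod p) ≠ 0 :=
  fun _ => natCast_zmod_ne_zero

lemma binomDual_inv_zmod (h5 : 5 < p) {k : ℕ} (hk : k < p) :
    binomDual p (fun m => 1 / (m : ZMod p)) k = 1 / k := by
  rcases Nat.eq_zero_or_pos k with rfl | h0
  · rw [binomDual_zero]
    simpa [hBelow] using hBelow_zmod_self (p := p) (m := 1) (by omega)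
  · rw [binomDual_inv natCast_zmod_ne_zero' h0 hk, choose_pred_zmod hk]

lemma binomDual_inv_sq_zmod (h5 : 5 < p) {k : ℕ} (hk : k < p) :
    binomDual p (fun m => 1 / (m : ZMod p) ^ 2) k = -hBelow (ZMod p) 1 k / k := by
  rcases Nat.eq_zero_or_pos k with rfl | h0
  · rw [binomDual_zero]
    simpa [hBelow] using hBelow_zmod_self (p := p) (m := 2) (by omega)
  · have := binomDual_div (K := ZMod p) natCast_zmod_ne_zero' (f := fun m => 1 / (m : ZMod p))
      (by simp) h0 hk
    rw [sum_congr rfl fun j hj => binomDual_inv_zmod h5 (by rw [mem_range] at hj; omega)] at this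
    simp only [div_div, ← sq] at this
    rw [this, hBelow]; simp

lemma binomDual_inv_cube_zmod (h5 : 5 < p) {k : ℕ} (hk : k < p) :
    binomDual p (fun m => 1 / (m : ZMod p) ^ 3) k = eBelow₂ (ZMod p) k / k := by
  rcases Nat.eq_zero_or_pos k with rfl | h0
  · rw [binomDual_zero]
    simpa [hBelow] using hBelow_zmod_self (p := p) (m := 3) (by omega)
  · have := binomDual_div (K := ZMod p) natCast_zmod_ne_zero'
      (f := fun m => 1 / (m : ZMod p) ^ 2) (by simp) h0 hk
    rw [sum_congr rfl fun j hj => binomDual_inv_sq_zmod h5 (by rw [mem_range] at hj; omega)] at this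
    simp only [div_div, ← pow_succ, neg_div, sum_neg_distrib, neg_neg] at this
    rw [this, eBelow₂]

lemma eBelow₂_zmod_self (h5 : 5 < p) : eBelow₂ (ZMod p) p = 0 := by
  have := two_mul_eBelow₂ (K := ZMod p) p
  rw [hBelow_zmod_self (by omega), hBelow_zmod_self (by omega)] at this
  have h2 := natCast_zmod_ne_zero (p := p) (k := 2) (by omega) (by omega)
  simpa [show (2 : ZMod p) ≠ 0 by exact_mod_cast h2] using this

lemma binomDual_hBelow_div_zmod (h5 : 5 < p) {k : ℕ} (hk : k < p) :
    binomDual p (fun m => hBelow (ZMod p) 1 m / (m : ZMod p)) k = -1 / (k : ZMod p) ^ 2 := by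
  rcases Nat.eq_zero_or_pos k with rfl | h0
  · rw [binomDual_zero]
    simpa [eBelow₂] using eBelow₂_zmod_self h5
  · rw [binomDual_hBelow_div natCast_zmod_ne_zero' h0 hk, choose_pred_zmod hk,
      hBelow_zmod_self (by omega)]
    ring

lemma binomDual_hBelow_div_sq_zmod (h5 : 5 < p) {k : ℕ} (h0 : 0 < k) (hk : k < p) :
    binomDual p (fun m => hBelow (ZMod p) 1 m / (m : ZMod p) ^ 2) k =
      hBelow (ZMod p) 2 k / k := by
  have := binomDual_div (K := ZMod p) natCast_zmod_ne_zero'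
    (f := fun m => hBelow (ZMod p) 1 m / (m : ZMod p)) (by simp) h0 hk
  rw [sum_congr rfl fun j hj => binomDual_hBelow_div_zmod h5 (by rw [mem_range] at hj; omega)]
    at this
  simp only [div_div, ← sq, neg_div, sum_neg_distrib, neg_neg] at this
  rw [this, hBelow]

/-- The sum `∑_{0 < k < p} x ^ k H_{k-1} / k ^ 2` at `1 - x`. -/
lemma sum_hBelow_div_sq_mul_one_sub_pow (h5 : 5 < p) (x : ZMod p) :
    ∑ m ∈ range p, hBelow (ZMod p) 1 m / (m : ZMod p) ^ 2 * (1 - x) ^ m =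
      ∑ m ∈ range p, hBelow (ZMod p) 1 m / (m : ZMod p) ^ 2 +
        ∑ k ∈ range p, hBelow (ZMod p) 2 k / k * x ^ k := by
  rw [sum_mul_one_sub_pow]
  obtain ⟨n, hn⟩ : ∃ n, p = n + 1 := ⟨p - 1, by omega⟩
  have h1 : ∀ f : ℕ → ZMod p, ∑ k ∈ range p, f k = ∑ k ∈ range n, f (k + 1) + f 0 := by
    intro f
    rw [show range p = range (n + 1) by rw [hn], sum_range_succ']
  rw [h1, h1 (fun k => hBelow (ZMod p) 2 k / k * x ^ k), binomDual_zero]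
  simp only [Nat.cast_zero, div_zero, add_zero, pow_zero, mul_one]
  rw [add_comm]
  congr 1
  refine sum_congr rfl fun k hk => ?_
  rw [mem_range] at hk
  rw [binomDual_hBelow_div_sq_zmod h5 (by omega) (by omega)]

end ZModSums

/-! ### Products of sums at 2 and reversal at -1 -/

section ZModEval

open Finset

variable {p : ℕ} [Fact p.Prime]

/-- Partial fractions 1/(j(n-j)) = (1/n)(1/j + 1/(n-j)). The condition on a + b makes the interval
invariant under j ↦ n - j, so both halves have the same sum. It is applied with n = m and with the
wrapped index n = m + p. -/
lemma sum_Ico_inv_mul_inv {K : Type*} [Field K] {a b n : ℕ} (hab : a + b = n + 1)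
    (hn : (n : K) ≠ 0) (h0 : ∀ j ∈ Ico a b, (j : K) ≠ 0) :
    ∑ j ∈ Ico a b, 1 / (j : K) * (1 / ((n - j : ℕ) : K)) =
      2 / n * ∑ j ∈ Ico a b, 1 / (j : K) := by
  rcases le_or_gt b a with h | h
  · simp [Ico_eq_empty_of_le h]
  have hr := sum_Ico_reflect (fun j => 1 / (j : K)) a (show b ≤ n + 1 by omega)
  rw [show n + 1 - b = a by omega, show n + 1 - a = b by omega] at hr
  rw [show (2 : K) / n = 1 / n + 1 / n by ring, add_mul]
  nth_rewrite 2 [← hr]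
  rw [mul_sum, mul_sum, ← sum_add_distrib]
  refine sum_congr rfl fun j hj => ?_
  have h1 := h0 j hj
  have h2 := h0 (n - j) (by rw [mem_Ico] at hj ⊢; omega)
  rw [mem_Ico] at hj
  have h3 : (n : K) = j + (n - j : ℕ) := by rw [← Nat.cast_add]; congr 1; omega
  rw [h3] at hn ⊢
  field_simp
  ring

lemma sum_Ico_inv_mul_inv_sq {K : Type*} [Field K] {a b n : ℕ} (hab : a + b = n + 1)
    (hn : (n : K) ≠ 0) (h0 : ∀ j ∈ Ico a b, (j : K) ≠ 0) :
    ∑ j ∈ Ico a b, 1 / (j : K) * (1 / ((n - j : ℕ) : K) ^ 2) =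
      2 / (n : K) ^ 2 * ∑ j ∈ Ico a b, 1 / (j : K) +
        1 / n * ∑ j ∈ Ico a b, 1 / (j : K) ^ 2 := by
  rcases le_or_gt b a with h | h
  · simp [Ico_eq_empty_of_le h]
  have hr := sum_Ico_reflect (fun j => 1 / (j : K) ^ 2) a (show b ≤ n + 1 by omega)
  rw [show n + 1 - b = a by omega, show n + 1 - a = b by omega] at hr
  rw [show 2 / (n : K) ^ 2 = 1 / n * (2 / n) by ring, mul_assoc,
    ← sum_Ico_inv_mul_inv hab hn h0, ← hr]
  rw [mul_sum, mul_sum, ← sum_add_distrib]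
  refine sum_congr rfl fun j hj => ?_
  have h1 := h0 j hj
  have h2 := h0 (n - j) (by rw [mem_Ico] at hj ⊢; omega)
  rw [mem_Ico] at hj
  have h3 : (n : K) = j + (n - j : ℕ) := by rw [← Nat.cast_add]; congr 1; omega
  rw [h3] at hn ⊢
  field_simp
  ring

lemma sum_Ico_one_eq_hBelow {K : Type*} [Field K] {m : ℕ} (hm : 0 < m) {n : ℕ} (hn : 0 < n) :
    ∑ j ∈ Ico 1 n, 1 / (j : K) ^ m = hBelow K m n := by
  rw [hBelow, range_eq_Ico, sum_eq_sum_Ico_succ_bot hn]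
  simp [hm.ne']

lemma sum_Ico_eq_neg_hBelow {m : ℕ} (hp : m < p - 1) {n : ℕ} (hn : n < p) :
    ∑ j ∈ Ico (n + 1) p, 1 / (j : ZMod p) ^ m = -hBelow (ZMod p) m (n + 1) := by
  rw [sum_Ico_eq_sub _ (by omega : n + 1 ≤ p)]
  have := hBelow_zmod_self (p := p) hp
  rw [hBelow] at this ⊢
  rw [this, zero_sub]

/-- The product of two polynomials of degree less than `p`, evaluated at `2 : ZMod p`. -/
lemma sum_mul_sum_two_pow (f g : ℕ → ZMod p) :
    (∑ j ∈ range p, f j * 2 ^ j) * ∑ k ∈ range p, g k * 2 ^ k =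
      ∑ m ∈ range p, (∑ j ∈ range (m + 1), f j * g (m - j) +
        2 * ∑ j ∈ Ico (m + 1) p, f j * g (m + p - j)) * 2 ^ m := by
  rw [sum_mul_sum, sum_range_sum_range_wrap p]
  refine sum_congr rfl fun m hm => ?_
  rw [add_mul, mul_assoc 2, mul_comm 2, sum_mul, sum_mul, sum_mul]
  congr 1
  · refine sum_congr rfl fun j hj => ?_
    rw [mem_range] at hj
    have : (2 : ZMod p) ^ m = 2 ^ j * 2 ^ (m - j) := by rw [← pow_add]; congr 1; omega
    rw [this]; ring
  · refine sum_congr rfl fun j hj => ?_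
    rw [mem_Ico] at hj
    have : (2 : ZMod p) ^ m * 2 = 2 ^ j * 2 ^ (m + p - j) := by
      rw [← pow_add, show j + (m + p - j) = m + p by omega, pow_add, ZMod.pow_card]
    linear_combination (-f j * g (m + p - j)) * this

lemma sum_range_eq_sum_Ico_of_zero {A : Type*} [AddCommMonoid A] {f : ℕ → A} {m : ℕ} (hm : 0 < m)
    (h0 : f 0 = 0) (h1 : f m = 0) : ∑ j ∈ range (m + 1), f j = ∑ j ∈ Ico 1 m, f j := by
  rw [sum_range_succ, h1, add_zero, range_eq_Ico, sum_eq_sum_Ico_succ_bot hm, h0, zero_add]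

lemma cast_Ico_ne_zero {a b : ℕ} (ha : 0 < a) (hb : b ≤ p) : ∀ j ∈ Ico a b, (j : ZMod p) ≠ 0 :=
  fun j hj => by rw [mem_Ico] at hj; exact natCast_zmod_ne_zero (by omega) (by omega)

lemma sum_inv_mul_self (h5 : 5 < p) :
    (∑ j ∈ range p, 1 / (j : ZMod p) * 2 ^ j) * ∑ k ∈ range p, 1 / (k : ZMod p) * 2 ^ k =
      ∑ m ∈ range p, (2 / m * hBelow (ZMod p) 1 m -
        2 * (2 / m * hBelow (ZMod p) 1 (m + 1))) * 2 ^ m := by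
  rw [sum_mul_sum_two_pow]
  refine sum_congr rfl fun m hm => ?_
  rw [mem_range] at hm
  congr 1
  rcases Nat.eq_zero_or_pos m with rfl | h0
  -- For m = 0 the wrapped index is p, which is zero in `ZMod p`, so partial fractions are
  -- unavailable. Instead p - j ≡ -j turns the convolution into a vanishing full power sum.
  · have h := sum_Ico_eq_neg_hBelow (p := p) (m := 2) (by omega) (show 0 < p by omega)
    have : ∑ j ∈ Ico (0 + 1) p, 1 / (j : ZMod p) * (1 / ((0 + p - j : ℕ) : ZMod p)) = 0 := by
      rw [← neg_eq_zero, ← sum_neg_distrib]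
      refine (sum_congr rfl fun j hj => ?_).trans (h.trans (by simp [hBelow]))
      rw [mem_Ico] at hj
      rw [zero_add, natCast_sub_zmod hj.2.le, ← pow_one (-(j : ZMod p)), one_div_neg_pow]
      ring
    rw [this]; simp
  · have hm0 := natCast_zmod_ne_zero h0 hm
    rw [sum_range_eq_sum_Ico_of_zero h0 (by simp) (by simp),
      sum_Ico_inv_mul_inv (by omega) hm0 (cast_Ico_ne_zero (by omega) hm.le),
      sum_Ico_inv_mul_inv (by omega) (by simpa using hm0)
        (cast_Ico_ne_zero (by omega) le_rfl)]
    have h1 := sum_Ico_one_eq_hBelow (K := ZMod p) one_pos h0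
    have h2 := sum_Ico_eq_neg_hBelow (p := p) (m := 1) (by omega) hm
    simp only [pow_one] at h1 h2
    rw [h1, h2]; push_cast; rw [CharP.cast_eq_zero (ZMod p) p, add_zero]; ring

lemma sum_inv_mul_sum_inv_sq (h5 : 5 < p) :
    (∑ j ∈ range p, 1 / (j : ZMod p) * 2 ^ j) * ∑ k ∈ range p, 1 / (k : ZMod p) ^ 2 * 2 ^ k =
      ∑ m ∈ range p, (2 / (m : ZMod p) ^ 2 * hBelow (ZMod p) 1 m + 1 / m * hBelow (ZMod p) 2 m -
        2 * (2 / (m : ZMod p) ^ 2 * hBelow (ZMod p) 1 (m + 1) +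
          1 / m * hBelow (ZMod p) 2 (m + 1))) * 2 ^ m := by
  rw [sum_mul_sum_two_pow]
  refine sum_congr rfl fun m hm => ?_
  rw [mem_range] at hm
  congr 1
  rcases Nat.eq_zero_or_pos m with rfl | h0
  · have h := sum_Ico_eq_neg_hBelow (p := p) (m := 3) (by omega) (show 0 < p by omega)
    have : ∑ j ∈ Ico (0 + 1) p, 1 / (j : ZMod p) * (1 / ((0 + p - j : ℕ) : ZMod p) ^ 2) = 0 := by
      refine (sum_congr rfl fun j hj => ?_).trans (h.trans (by simp [hBelow]))
      rw [mem_Ico] at hj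
      rw [zero_add, natCast_sub_zmod hj.2.le, one_div_neg_pow]
      ring
    rw [this]; simp
  · have hm0 := natCast_zmod_ne_zero h0 hm
    rw [sum_range_eq_sum_Ico_of_zero h0 (by simp) (by simp),
      sum_Ico_inv_mul_inv_sq (by omega) hm0 (cast_Ico_ne_zero (by omega) hm.le),
      sum_Ico_inv_mul_inv_sq (by omega) (by simpa using hm0)
        (cast_Ico_ne_zero (by omega) le_rfl)]
    have h1 := sum_Ico_one_eq_hBelow (K := ZMod p) one_pos h0
    have h2 := sum_Ico_eq_neg_hBelow (p := p) (m := 1) (by omega) hm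
    have h3 := sum_Ico_one_eq_hBelow (K := ZMod p) two_pos h0
    have h4 := sum_Ico_eq_neg_hBelow (p := p) (m := 2) (by omega) hm
    simp only [pow_one] at h1 h2
    rw [h1, h2, h3, h4]; push_cast; rw [CharP.cast_eq_zero (ZMod p) p, add_zero]; ring

/-- Replacing `k` by `p - k` in an alternating sum. -/
lemma sum_mul_neg_one_pow_reverse (h5 : 5 < p) {f g : ℕ → ZMod p} (h0 : f 0 = 0) (hp : f p = 0)
    (hg : ∀ k < p, f (p - k) = g k) :
    ∑ k ∈ range p, f k * (-1) ^ k = -∑ k ∈ range p, g k * (-1) ^ k := by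
  have hodd : Odd p := (Fact.out : p.Prime).odd_of_ne_two (by omega)
  rw [sum_range_reverse (by rw [h0, hp]; simp), ← sum_neg_distrib]
  refine sum_congr rfl fun k hk => ?_
  rw [mem_range] at hk
  have h1 : (-1 : ZMod p) ^ (p - k) * (-1) ^ k = -1 := by
    rw [← pow_add, show p - k + k = p by omega, hodd.neg_one_pow]
  have h2 : (-1 : ZMod p) ^ k * (-1) ^ k = 1 := by rw [← mul_pow]; simp
  rw [hg k hk]
  linear_combination g k * (-1) ^ k * h1 - g k * (-1) ^ (p - k) * h2

lemma two_ne_zero_zmod (h5 : 5 < p) : (2 : ZMod p) ≠ 0 := by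
  exact_mod_cast natCast_zmod_ne_zero (p := p) (k := 2) (by omega) (by omega)

lemma sum_inv_sq_mul_neg_one_pow (h5 : 5 < p) :
    ∑ k ∈ range p, 1 / (k : ZMod p) ^ 2 * (-1) ^ k = 0 := by
  have h := sum_mul_neg_one_pow_reverse h5 (f := fun k => 1 / (k : ZMod p) ^ 2)
    (g := fun k => 1 / (k : ZMod p) ^ 2) (by simp) (by simp)
    (fun k hk => by rw [natCast_sub_zmod hk.le, one_div_neg_pow]; ring)
  exact (mul_eq_zero.1 (show (2 : ZMod p) * _ = 0 by linear_combination h)).resolve_left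
    (two_ne_zero_zmod h5)

lemma two_mul_sum_hBelow_one_div_sq (h5 : 5 < p) :
    2 * ∑ k ∈ range p, hBelow (ZMod p) 1 k / (k : ZMod p) ^ 2 * (-1) ^ k =
      -∑ k ∈ range p, 1 / (k : ZMod p) ^ 3 * (-1) ^ k := by
  have h := sum_mul_neg_one_pow_reverse h5
    (f := fun k => hBelow (ZMod p) 1 k / (k : ZMod p) ^ 2)
    (g := fun k => hBelow (ZMod p) 1 k / (k : ZMod p) ^ 2 + 1 / (k : ZMod p) ^ 3)
    (by simp) (by simp) (fun k hk => by
      rw [natCast_sub_zmod hk.le, hBelow_zmod_reflect one_pos (by omega) hk, hBelow_succ,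
        div_eq_mul_one_div _ ((-(k : ZMod p)) ^ 2), one_div_neg_pow]; ring)
  simp only [add_mul, sum_add_distrib] at h
  linear_combination h

lemma two_mul_sum_hBelow_two_div (h5 : 5 < p) :
    2 * ∑ k ∈ range p, hBelow (ZMod p) 2 k / (k : ZMod p) * (-1) ^ k =
      -∑ k ∈ range p, 1 / (k : ZMod p) ^ 3 * (-1) ^ k := by
  have h := sum_mul_neg_one_pow_reverse h5
    (f := fun k => hBelow (ZMod p) 2 k / (k : ZMod p))
    (g := fun k => hBelow (ZMod p) 2 k / (k : ZMod p) + 1 / (k : ZMod p) ^ 3)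
    (by simp) (by simp) (fun k hk => by
      rw [natCast_sub_zmod hk.le, hBelow_zmod_reflect two_pos (by omega) hk, hBelow_succ,
        div_eq_mul_one_div _ (-(k : ZMod p)), ← pow_one (-(k : ZMod p)), one_div_neg_pow]
      ring)
  simp only [add_mul, sum_add_distrib] at h
  linear_combination h

end ZModEval

/-! ### Values of the sums modulo p -/

section ZModValues

open Finset

variable {p : ℕ} [Fact p.Prime]

/-- The square of ∑ 2^k/k brings in ∑ 2^k H_{k-1}/k, which is dual to ∑ (-1)^k/k^2 and therefore
zero. -/
lemma four_mul_sum_two_pow_div_sq (h5 : 5 < p) :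
    4 * ∑ k ∈ range p, 1 / (k : ZMod p) ^ 2 * 2 ^ k =
      -(∑ k ∈ range p, 1 / (k : ZMod p) * 2 ^ k) ^ 2 := by
  have h1 := sum_inv_mul_self (p := p) h5
  have h2 := sum_mul_one_sub_pow p (fun m => 1 / (m : ZMod p) ^ 2) 2
  rw [show (1 : ZMod p) - 2 = -1 by ring, sum_inv_sq_mul_neg_one_pow h5,
    sum_congr rfl fun k hk => by rw [binomDual_inv_sq_zmod h5 (by simpa using hk)]] at h2
  have h3 : ∑ m ∈ range p, (2 / m * hBelow (ZMod p) 1 m -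
        2 * (2 / m * hBelow (ZMod p) 1 (m + 1))) * 2 ^ m =
      2 * ∑ k ∈ range p, -hBelow (ZMod p) 1 k / k * 2 ^ k -
        4 * ∑ k ∈ range p, 1 / (k : ZMod p) ^ 2 * 2 ^ k := by
    rw [mul_sum, mul_sum, ← sum_sub_distrib]
    exact sum_congr rfl fun k _ => by rw [hBelow_succ]; ring
  rw [h3, ← h2] at h1
  linear_combination h1

lemma two_mul_sum_hBelow_one_div_sq_two_pow (h5 : 5 < p) :
    2 * ∑ k ∈ range p, hBelow (ZMod p) 1 k / (k : ZMod p) ^ 2 * 2 ^ k =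
      2 * ∑ k ∈ range p, hBelow (ZMod p) 1 k / (k : ZMod p) ^ 2 -
        ∑ k ∈ range p, 1 / (k : ZMod p) ^ 3 * (-1) ^ k := by
  have h := sum_hBelow_div_sq_mul_one_sub_pow (p := p) h5 (-1)
  rw [show (1 : ZMod p) - -1 = 2 by ring] at h
  linear_combination 2 * h + two_mul_sum_hBelow_two_div h5

lemma two_mul_sum_hBelow_two_div_two_pow (h5 : 5 < p) :
    2 * ∑ k ∈ range p, hBelow (ZMod p) 2 k / (k : ZMod p) * 2 ^ k =
      -2 * ∑ k ∈ range p, hBelow (ZMod p) 1 k / (k : ZMod p) ^ 2 -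
        ∑ k ∈ range p, 1 / (k : ZMod p) ^ 3 * (-1) ^ k := by
  have h := sum_hBelow_div_sq_mul_one_sub_pow (p := p) h5 2
  rw [show (1 : ZMod p) - 2 = -1 by ring] at h
  linear_combination -2 * h + two_mul_sum_hBelow_one_div_sq h5

lemma sum_eBelow₂_div_two_pow (h5 : 5 < p) :
    ∑ k ∈ range p, eBelow₂ (ZMod p) k / (k : ZMod p) * 2 ^ k =
      ∑ k ∈ range p, 1 / (k : ZMod p) ^ 3 * (-1) ^ k := by
  have h2 := sum_mul_one_sub_pow p (fun m => 1 / (m : ZMod p) ^ 3) 2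
  rw [show (1 : ZMod p) - 2 = -1 by ring] at h2
  rw [h2]
  exact sum_congr rfl fun k hk => by rw [binomDual_inv_cube_zmod h5 (by simpa using hk)]

/-- Newton's identity splits H_{k-1}^2 as 2e₂ + H_{k-1,2}, and both pieces are known by duality. -/
lemma sum_hBelow_one_sq_div_two_pow (h5 : 5 < p) :
    2 * ∑ k ∈ range p, hBelow (ZMod p) 1 k ^ 2 / (k : ZMod p) * 2 ^ k =
      -2 * ∑ k ∈ range p, hBelow (ZMod p) 1 k / (k : ZMod p) ^ 2 +
        3 * ∑ k ∈ range p, 1 / (k : ZMod p) ^ 3 * (-1) ^ k := by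
  have h : ∑ k ∈ range p, hBelow (ZMod p) 1 k ^ 2 / (k : ZMod p) * 2 ^ k =
      2 * ∑ k ∈ range p, eBelow₂ (ZMod p) k / (k : ZMod p) * 2 ^ k +
        ∑ k ∈ range p, hBelow (ZMod p) 2 k / (k : ZMod p) * 2 ^ k := by
    rw [mul_sum, ← sum_add_distrib]
    refine sum_congr rfl fun k _ => ?_
    linear_combination (-1 / (k : ZMod p) * 2 ^ k) * two_mul_eBelow₂ (K := ZMod p) k
  rw [h, sum_eBelow₂_div_two_pow h5]
  linear_combination two_mul_sum_hBelow_two_div_two_pow h5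

lemma twelve_mul_sum_two_pow_div_cube (h5 : 5 < p) :
    12 * ∑ k ∈ range p, 1 / (k : ZMod p) ^ 3 * 2 ^ k =
      -2 * ((∑ k ∈ range p, 1 / (k : ZMod p) * 2 ^ k) *
        ∑ k ∈ range p, 1 / (k : ZMod p) ^ 2 * 2 ^ k) -
      2 * ∑ k ∈ range p, hBelow (ZMod p) 1 k / (k : ZMod p) ^ 2 +
        3 * ∑ k ∈ range p, 1 / (k : ZMod p) ^ 3 * (-1) ^ k := by
  have h1 := sum_inv_mul_sum_inv_sq (p := p) h5
  have h3 : ∑ m ∈ range p, (2 / (m : ZMod p) ^ 2 * hBelow (ZMod p) 1 m +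
      1 / m * hBelow (ZMod p) 2 m - 2 * (2 / (m : ZMod p) ^ 2 * hBelow (ZMod p) 1 (m + 1) +
          1 / m * hBelow (ZMod p) 2 (m + 1))) * 2 ^ m =
      -2 * ∑ k ∈ range p, hBelow (ZMod p) 1 k / (k : ZMod p) ^ 2 * 2 ^ k -
        ∑ k ∈ range p, hBelow (ZMod p) 2 k / (k : ZMod p) * 2 ^ k -
        6 * ∑ k ∈ range p, 1 / (k : ZMod p) ^ 3 * 2 ^ k := by
    rw [mul_sum, mul_sum, ← sum_sub_distrib, ← sum_sub_distrib]
    exact sum_congr rfl fun k _ => by rw [hBelow_succ, hBelow_succ]; ring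
  rw [h3] at h1
  linear_combination 2 * h1 - 2 * two_mul_sum_hBelow_one_div_sq_two_pow h5
    - two_mul_sum_hBelow_two_div_two_pow h5

variable {q κ : ZMod p}

lemma sum_two_pow_div_sq_eq (h5 : 5 < p)
    (hL : ∑ k ∈ range p, 1 / (k : ZMod p) * 2 ^ k = -2 * q) :
    ∑ k ∈ range p, 1 / (k : ZMod p) ^ 2 * 2 ^ k = -q ^ 2 := by
  have h := four_mul_sum_two_pow_div_sq (p := p) h5
  rw [hL] at h
  have h2 := two_ne_zero_zmod h5
  exact mul_left_cancel₀ (mul_ne_zero h2 h2) (by linear_combination h)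

lemma sum_two_pow_div_cube_eq (h5 : 5 < p)
    (hL : ∑ k ∈ range p, 1 / (k : ZMod p) * 2 ^ k = -2 * q)
    (hκ : ∑ k ∈ range p, hBelow (ZMod p) 1 k / (k : ZMod p) ^ 2 = κ)
    (ha : 2 * ∑ k ∈ range p, 1 / (k : ZMod p) ^ 3 * (-1) ^ k = -κ) :
    24 * ∑ k ∈ range p, 1 / (k : ZMod p) ^ 3 * 2 ^ k = -8 * q ^ 3 - 7 * κ := by
  have h := twelve_mul_sum_two_pow_div_cube (p := p) h5
  rw [hL, sum_two_pow_div_sq_eq h5 hL, hκ] at h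
  linear_combination 2 * h + 3 * ha

lemma sum_two_pow_mul_harmonic_div_sq (h5 : 5 < p)
    (hL : ∑ k ∈ range p, 1 / (k : ZMod p) * 2 ^ k = -2 * q)
    (hκ : ∑ k ∈ range p, hBelow (ZMod p) 1 k / (k : ZMod p) ^ 2 = κ)
    (ha : 2 * ∑ k ∈ range p, 1 / (k : ZMod p) ^ 3 * (-1) ^ k = -κ) :
    24 * ∑ k ∈ range p, 2 ^ k * hBelow (ZMod p) 1 (k + 1) / (k : ZMod p) ^ 2 =
      -8 * q ^ 3 + 23 * κ := by
  have h1 := sum_two_pow_div_cube_eq h5 hL hκ ha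
  have h2 := two_mul_sum_hBelow_one_div_sq_two_pow (p := p) h5
  have h3 : ∑ k ∈ range p, 2 ^ k * hBelow (ZMod p) 1 (k + 1) / (k : ZMod p) ^ 2 =
      ∑ k ∈ range p, hBelow (ZMod p) 1 k / (k : ZMod p) ^ 2 * 2 ^ k +
        ∑ k ∈ range p, 1 / (k : ZMod p) ^ 3 * 2 ^ k := by
    rw [← sum_add_distrib]
    exact sum_congr rfl fun k _ => by rw [hBelow_succ]; ring
  rw [hκ] at h2
  rw [h3]
  linear_combination h1 + 12 * h2 - 6 * ha

lemma sum_two_pow_mul_harmonicOrd_two_div (h5 : 5 < p)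
    (hL : ∑ k ∈ range p, 1 / (k : ZMod p) * 2 ^ k = -2 * q)
    (hκ : ∑ k ∈ range p, hBelow (ZMod p) 1 k / (k : ZMod p) ^ 2 = κ)
    (ha : 2 * ∑ k ∈ range p, 1 / (k : ZMod p) ^ 3 * (-1) ^ k = -κ) :
    24 * ∑ k ∈ range p, 2 ^ k * hBelow (ZMod p) 2 (k + 1) / (k : ZMod p) =
      -8 * q ^ 3 - 25 * κ := by
  have h1 := sum_two_pow_div_cube_eq h5 hL hκ ha
  have h2 := two_mul_sum_hBelow_two_div_two_pow (p := p) h5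
  have h3 : ∑ k ∈ range p, 2 ^ k * hBelow (ZMod p) 2 (k + 1) / (k : ZMod p) =
      ∑ k ∈ range p, hBelow (ZMod p) 2 k / (k : ZMod p) * 2 ^ k +
        ∑ k ∈ range p, 1 / (k : ZMod p) ^ 3 * 2 ^ k := by
    rw [← sum_add_distrib]
    exact sum_congr rfl fun k _ => by rw [hBelow_succ]; ring
  rw [hκ] at h2
  rw [h3]
  linear_combination h1 + 12 * h2 - 6 * ha

lemma sum_two_pow_mul_harmonic_sq_div (h5 : 5 < p)
    (hL : ∑ k ∈ range p, 1 / (k : ZMod p) * 2 ^ k = -2 * q)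
    (hκ : ∑ k ∈ range p, hBelow (ZMod p) 1 k / (k : ZMod p) ^ 2 = κ)
    (ha : 2 * ∑ k ∈ range p, 1 / (k : ZMod p) ^ 3 * (-1) ^ k = -κ) :
    24 * ∑ k ∈ range p, 2 ^ k * hBelow (ZMod p) 1 (k + 1) ^ 2 / (k : ZMod p) =
      -8 * q ^ 3 + 11 * κ := by
  have h1 := sum_two_pow_div_cube_eq h5 hL hκ ha
  have h2 := sum_hBelow_one_sq_div_two_pow (p := p) h5
  have h4 := two_mul_sum_hBelow_one_div_sq_two_pow (p := p) h5
  have h3 : ∑ k ∈ range p, 2 ^ k * hBelow (ZMod p) 1 (k + 1) ^ 2 / (k : ZMod p) =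
      ∑ k ∈ range p, hBelow (ZMod p) 1 k ^ 2 / (k : ZMod p) * 2 ^ k +
        2 * ∑ k ∈ range p, hBelow (ZMod p) 1 k / (k : ZMod p) ^ 2 * 2 ^ k +
        ∑ k ∈ range p, 1 / (k : ZMod p) ^ 3 * 2 ^ k := by
    rw [mul_sum, ← sum_add_distrib, ← sum_add_distrib]
    exact sum_congr rfl fun k _ => by rw [hBelow_succ]; ring
  rw [hκ] at h2 h4
  rw [h3]
  linear_combination h1 + 12 * h2 + 24 * h4 + 6 * ha

lemma two_pow_sub_mul_two_pow {k : ℕ} (hk : k ≤ p) : (2 : ZMod p) ^ (p - k) * 2 ^ k = 2 := by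
  rw [← pow_add, Nat.sub_add_cancel hk, ZMod.pow_card]

lemma harmonic_reflect_zmod (h5 : 5 < p) {k : ℕ} (h0 : 0 < k) (hk : k ≤ p) :
    hBelow (ZMod p) 1 (p - k + 1) = hBelow (ZMod p) 1 k := by
  have h := hBelow_zmod_reflect (p := p) (m := 1) one_pos (by omega)
    (show k - 1 < p by omega)
  rw [show p - (k - 1) = p - k + 1 by omega, show k - 1 + 1 = k by omega] at h
  rw [h]; ring

lemma sum_harmonic_div_sq_mul_two_pow (h5 : 5 < p)
    (hκ : ∑ k ∈ range p, hBelow (ZMod p) 1 k / (k : ZMod p) ^ 2 = κ)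
    (ha : 2 * ∑ k ∈ range p, 1 / (k : ZMod p) ^ 3 * (-1) ^ k = -κ) :
    8 * ∑ k ∈ range p, hBelow (ZMod p) 1 (k + 1) / ((k : ZMod p) ^ 2 * 2 ^ k) = 5 * κ := by
  have h2 := two_mul_sum_hBelow_one_div_sq_two_pow (p := p) h5
  have two := two_ne_zero_zmod h5
  -- Under k ↦ p - k the harmonic number H_k becomes H_{k-1}, and 2^p = 2 turns 1/2^k into 2^k/2,
  -- which explains the factor 2.
  have h3 : 2 * ∑ k ∈ range p, hBelow (ZMod p) 1 (k + 1) / ((k : ZMod p) ^ 2 * 2 ^ k) =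
      ∑ k ∈ range p, hBelow (ZMod p) 1 k / (k : ZMod p) ^ 2 * 2 ^ k := by
    rw [sum_range_reverse (by simp), mul_sum]
    refine sum_congr rfl fun k hk => ?_
    rw [mem_range] at hk
    rcases Nat.eq_zero_or_pos k with rfl | h0
    · simp
    have e := two_pow_sub_mul_two_pow hk.le
    have hk0 := natCast_zmod_ne_zero h0 hk
    rw [harmonic_reflect_zmod h5 h0 hk.le, natCast_sub_zmod hk.le, neg_sq]
    have := pow_ne_zero (p - k) two
    field_simp
    linear_combination -hBelow (ZMod p) 1 k * e
  rw [hκ] at h2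
  linear_combination 4 * h3 + 2 * h2 - ha

lemma sum_harmonic_sq_div_mul_two_pow (h5 : 5 < p)
    (hκ : ∑ k ∈ range p, hBelow (ZMod p) 1 k / (k : ZMod p) ^ 2 = κ)
    (ha : 2 * ∑ k ∈ range p, 1 / (k : ZMod p) ^ 3 * (-1) ^ k = -κ) :
    8 * ∑ k ∈ range p, hBelow (ZMod p) 1 (k + 1) ^ 2 / ((k : ZMod p) * 2 ^ k) = 7 * κ := by
  have h2 := sum_hBelow_one_sq_div_two_pow (p := p) h5
  have two := two_ne_zero_zmod h5
  have h3 : -2 * ∑ k ∈ range p, hBelow (ZMod p) 1 (k + 1) ^ 2 / ((k : ZMod p) * 2 ^ k) =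
      ∑ k ∈ range p, hBelow (ZMod p) 1 k ^ 2 / (k : ZMod p) * 2 ^ k := by
    rw [sum_range_reverse (by simp), mul_sum]
    refine sum_congr rfl fun k hk => ?_
    rw [mem_range] at hk
    rcases Nat.eq_zero_or_pos k with rfl | h0
    · simp
    have e := two_pow_sub_mul_two_pow hk.le
    have hk0 := natCast_zmod_ne_zero h0 hk
    rw [harmonic_reflect_zmod h5 h0 hk.le, natCast_sub_zmod hk.le]
    have := pow_ne_zero (p - k) two
    field_simp
    linear_combination -hBelow (ZMod p) 1 k ^ 2 * e
  rw [hκ] at h2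
  linear_combination -4 * h3 - 2 * h2 - 3 * ha

end ZModValues

/-! ### The Bernoulli number as a residue -/

section BernoulliResidue

open Finset

variable {p : ℕ} [Fact p.Prime]

lemma bernoulli'_mem_pIntegers {n : ℕ} (hn : n + 1 < p) : bernoulli' n ∈ pIntegers p := by
  induction n using Nat.strong_induction_on with
  | _ n ih =>
    rw [bernoulli'_def]
    refine sub_mem (one_mem _) (sum_mem fun k hk => ?_)
    rw [mem_range] at hk
    rw [mul_comm]
    refine mul_mem (ih k hk (by omega)) ?_
    rw [div_eq_mul_inv]
    refine mul_mem (natCast_mem _ _) ?_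
    rw [← Nat.cast_sub hk.le, ← Nat.cast_add_one]
    exact inv_natCast_mem (by omega)

lemma bernoulli_mem_pIntegers {n : ℕ} (hn : n + 1 < p) : bernoulli n ∈ pIntegers p := by
  rw [bernoulli]
  exact mul_mem (pow_mem (neg_mem (one_mem _)) _) (bernoulli'_mem_pIntegers hn)

lemma sum_range_pow_zmod {m : ℕ} (hm : 0 < m) :
    ∑ k ∈ range p, (k : ZMod p) ^ m = if p - 1 ∣ m then -1 else 0 := by
  have h := FiniteField.sum_pow_units (ZMod p) m
  rw [ZMod.card] at h
  rw [sum_range_zmod (fun x : ZMod p => x ^ m), ← h]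
  symm
  refine sum_of_injOn (fun u : (ZMod p)ˣ => (u : ZMod p)) (by intro a _ b _ h; exact Units.ext h)
    (by intro a _; simp) (fun x _ hx => ?_) (fun _ _ => rfl)
  have : x = 0 := by
    by_contra h0
    exact hx ⟨Units.mk0 x h0, by simp, rfl⟩
  rw [this, zero_pow hm.ne']

lemma one_div_zmod_eq_pow {k m : ℕ} (hm : 0 < m) (hm' : m < p - 1) :
    1 / (k : ZMod p) ^ m = (k : ZMod p) ^ (p - 1 - m) := by
  by_cases h : (k : ZMod p) = 0
  · rw [h, zero_pow hm.ne', zero_pow (by omega), div_zero]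
  · rw [div_eq_iff (pow_ne_zero _ h), ← pow_add, Nat.sub_add_cancel hm'.le,
      ZMod.pow_card_sub_one_eq_one h]

/-- Modulo p, 1/j is j^(p-2), so Faulhaber's formula makes H_{k-1} a polynomial in k with p-integral
Bernoulli coefficients. After multiplication by k^(p-3), which stands for 1/k^2, summing over k
detects only the exponent p - 1, that is i = p - 3. -/
lemma sum_hBelow_div_sq_eq_bernoulli (h5 : 5 < p) :
    ∑ k ∈ range p, hBelow (ZMod p) 1 k / (k : ZMod p) ^ 2 = (bernoulli (p - 3) : ZMod p) := by
  have hp1 : ((p - 1 : ℕ) : ZMod p) = -1 := by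
    rw [natCast_sub_zmod (p := p) (k := 1) (by omega)]; simp
  have h1 : ∀ k, hBelow (ZMod p) 1 k = -∑ i ∈ range (p - 1),
      (bernoulli i : ZMod p) * ((p - 1).choose i : ZMod p) * (k : ZMod p) ^ (p - 1 - i) := by
    intro k
    have hf := sum_range_pow k (p - 2)
    have hl : Reduces p (∑ j ∈ range k, (j : ℚ) ^ (p - 2)) (hBelow (ZMod p) 1 k) := by
      refine (Reduces.sum fun j _ => (Reduces.natCast j).pow (p - 2)).congr_right ?_
      exact sum_congr rfl fun j _ => by
        rw [one_div_zmod_eq_pow one_pos (by omega)]; congr 1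
    have hr : Reduces p (∑ i ∈ range (p - 2 + 1),
        bernoulli i * ((p - 2 + 1).choose i : ℚ) * (k : ℚ) ^ (p - 2 + 1 - i) / ((p - 2 : ℕ) + 1))
        (∑ i ∈ range (p - 1), (bernoulli i : ZMod p) * ((p - 1).choose i : ZMod p) *
          (k : ZMod p) ^ (p - 1 - i) / ((p - 1 : ℕ) : ZMod p)) := by
      rw [← Nat.cast_add_one, show p - 2 + 1 = p - 1 by omega]
      refine Reduces.sum fun i hi => ?_
      rw [mem_range] at hi
      exact (((Reduces.of_mem (bernoulli_mem_pIntegers (by omega))).mul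
        (Reduces.natCast _)).mul ((Reduces.natCast k).pow _)).div_natCast (by omega)
    rw [← hl.2, hf, hr.2, hp1, ← sum_neg_distrib]
    exact sum_congr rfl fun i _ => by rw [div_neg, div_one]
  have h2 : ∀ k, hBelow (ZMod p) 1 k / (k : ZMod p) ^ 2 = ∑ i ∈ range (p - 1),
      -((bernoulli i : ZMod p) * ((p - 1).choose i : ZMod p)) * (k : ZMod p) ^ (2 * p - 4 - i) := by
    intro k
    rw [div_eq_mul_one_div, one_div_zmod_eq_pow two_pos (by omega), h1, ← sum_neg_distrib, sum_mul]
    refine sum_congr rfl fun i hi => ?_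
    rw [mem_range] at hi
    rw [show 2 * p - 4 - i = (p - 1 - i) + (p - 1 - 2) by omega, pow_add]
    ring
  simp only [h2]
  rw [sum_comm, sum_eq_single (p - 3)]
  · rw [← mul_sum, sum_range_pow_zmod (by omega),
      if_pos (by rw [show 2 * p - 4 - (p - 3) = p - 1 by omega])]
    have h := choose_pred_zmod (p := p) (k := p - 3) (by omega)
    have hev : Even (p - 3) := by
      have := (Fact.out : p.Prime).odd_of_ne_two (by omega)
      exact Nat.Odd.sub_odd this (by decide)
    rw [hev.neg_one_pow, one_mul] at h
    rw [h]; ring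
  · intro i hi hne
    rw [mem_range] at hi
    rw [← mul_sum, sum_range_pow_zmod (by omega), if_neg, mul_zero]
    -- The exponent lies between p - 2 and 2p - 4, so its only possible value divisible by p - 1 is
    -- p - 1 itself, reached at the excluded index.
    rintro ⟨c, hc⟩
    have hc2 : c < 2 := by
      by_contra! h
      have := Nat.mul_le_mul_left (p - 1) h
      omega
    interval_cases c <;> omega
  · intro h; simp at h; omega

end BernoulliResidue

/-! ### The filtration by powers of p -/

section Multiples

open Finset

/-- The additive group `p ^ e ℤ_(p)`. -/
def pMultiples (p : ℕ) [Fact p.Prime] (e : ℕ) : AddSubgroup ℚ where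
  carrier := {x | ∃ c ∈ pIntegers p, x = (p : ℚ) ^ e * c}
  add_mem' := by
    rintro _ _ ⟨c, hc, rfl⟩ ⟨d, hd, rfl⟩
    exact ⟨c + d, add_mem hc hd, by ring⟩
  zero_mem' := ⟨0, zero_mem _, by simp⟩
  neg_mem' := by
    rintro _ ⟨c, hc, rfl⟩
    exact ⟨-c, neg_mem hc, by ring⟩

variable {p : ℕ} [Fact p.Prime]

lemma prime_cast_ne_zero : (p : ℚ) ≠ 0 := by
  exact_mod_cast (Fact.out : p.Prime).ne_zero

lemma mul_mem_pMultiples {e : ℕ} {c x : ℚ} (hc : c ∈ pIntegers p) (hx : x ∈ pMultiples p e) :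
    c * x ∈ pMultiples p e := by
  obtain ⟨d, hd, rfl⟩ := hx
  exact ⟨c * d, mul_mem hc hd, by ring⟩

lemma pow_mul_mem_pMultiples {e : ℕ} {c : ℚ} (hc : c ∈ pIntegers p) :
    (p : ℚ) ^ e * c ∈ pMultiples p e := ⟨c, hc, rfl⟩

lemma pow_mul_mem_pMultiples_add {d e : ℕ} {x : ℚ} (hx : x ∈ pMultiples p e) :
    (p : ℚ) ^ d * x ∈ pMultiples p (d + e) := by
  obtain ⟨c, hc, rfl⟩ := hx
  exact ⟨c, hc, by ring⟩

lemma mul_mem_pMultiples_add {d e : ℕ} {x y : ℚ} (hx : x ∈ pMultiples p d)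
    (hy : y ∈ pMultiples p e) : x * y ∈ pMultiples p (d + e) := by
  obtain ⟨c, hc, rfl⟩ := hx
  obtain ⟨c', hc', rfl⟩ := hy
  exact ⟨c * c', mul_mem hc hc', by ring⟩

lemma pMultiples_cancel {d e : ℕ} {x : ℚ} (hx : (p : ℚ) ^ d * x ∈ pMultiples p (d + e)) :
    x ∈ pMultiples p e := by
  obtain ⟨c, hc, h⟩ := hx
  refine ⟨c, hc, ?_⟩
  rw [pow_add, mul_assoc] at h
  exact mul_left_cancel₀ (pow_ne_zero d prime_cast_ne_zero) h

lemma pMultiples_le {d e : ℕ} (h : d ≤ e) {x : ℚ} (hx : x ∈ pMultiples p e) :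
    x ∈ pMultiples p d := by
  obtain ⟨c, hc, rfl⟩ := hx
  refine ⟨p ^ (e - d) * c, mul_mem (pow_mem (natCast_mem _ _) _) hc, ?_⟩
  rw [← mul_assoc, ← pow_add, Nat.add_sub_cancel' h]

/-- The factor 1 + pw is a unit. Rather than inverting it, each step feeds the known divisibility of
x into pwx and gains one power of p. -/
lemma mem_pMultiples_of_add_mul {e : ℕ} {x w : ℚ} (hx : x ∈ pIntegers p) (hw : w ∈ pIntegers p)
    (h : x + p * w * x ∈ pMultiples p e) : x ∈ pMultiples p e := by
  have key : ∀ d ≤ e, x ∈ pMultiples p d := by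
    intro d
    induction d with
    | zero => exact fun _ => ⟨x, hx, by simp⟩
    | succ d ih =>
      intro hd
      have h1 := pow_mul_mem_pMultiples_add (d := 1) (mul_mem_pMultiples hw (ih (by omega)))
      rw [add_comm 1 d] at h1
      have h2 := sub_mem (pMultiples_le hd h) h1
      rwa [pow_one, show x + p * w * x - p * (w * x) = x by ring] at h2
  exact key e le_rfl

lemma Reduces.mem_pMultiples_one {x : ℚ} (h : Reduces p x 0) : x ∈ pMultiples p 1 := by
  obtain ⟨c, hc, h⟩ := h.exists_eq_mul
  exact ⟨c, hc, by simpa using h⟩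

lemma Reduces.of_mem_pMultiples_one {x : ℚ} (h : x ∈ pMultiples p 1) : Reduces p x 0 := by
  obtain ⟨c, hc, rfl⟩ := h
  exact (((Reduces.natCast p).pow 1).mul (Reduces.of_mem hc)).congr_right (by simp)

lemma smooth_mem_pIntegers (h5 : 5 < p) (a : ℤ) (b c : ℕ) :
    (a : ℚ) / (2 ^ b * 3 ^ c) ∈ pIntegers p := by
  rw [div_eq_mul_inv, mul_inv, ← inv_pow, ← inv_pow]
  exact mul_mem (intCast_mem _ _) (mul_mem
    (pow_mem (by exact_mod_cast inv_natCast_mem (p := p) (k := 2) (by omega)) _)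
    (pow_mem (by exact_mod_cast inv_natCast_mem (p := p) (k := 3) (by omega)) _))

end Multiples

open Finset in
lemma sum_choose_Ico {p : ℕ} (hp : 0 < p) : ∑ k ∈ Ico 1 p, (p.choose k : ℚ) = 2 ^ p - 2 := by
  have h := Nat.sum_range_choose p
  rw [range_eq_Ico, sum_eq_sum_Ico_succ_bot (by omega), sum_Ico_succ_top (by omega)] at h
  have h' : (1 : ℚ) + (∑ k ∈ Ico 1 p, (p.choose k : ℚ) + 1) = 2 ^ p := by
    have := congrArg (Nat.cast : ℕ → ℚ) h
    push_cast at this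
    simpa using this
  linear_combination h'

/-! ### Expansions of the exact duality in powers of p -/

section Expansions

open Finset

variable {p : ℕ} [Fact p.Prime]

lemma hBelow_mem (m : ℕ) {k : ℕ} (hk : k ≤ p) : hBelow ℚ m k ∈ pIntegers p :=
  (Reduces.hBelow m hk).1

lemma eBelow₂_mem {k : ℕ} (hk : k ≤ p) : eBelow₂ ℚ k ∈ pIntegers p := (Reduces.eBelow₂ hk).1

lemma eBelow₃_mem {k : ℕ} (hk : k ≤ p) : eBelow₃ ℚ k ∈ pIntegers p := (Reduces.eBelow₃ hk).1

lemma one_div_natCast_pow_mem {k : ℕ} (hk : k < p) (m : ℕ) : 1 / (k : ℚ) ^ m ∈ pIntegers p :=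
  (Reduces.one.div_natCast_pow hk m).1

/-- The factor at j = 0 is 1 by the convention for division by zero. The parameter s is needed for
the values 1 and 1/2, which are compared in the half-range product. -/
lemma prod_one_sub_div_expand {s : ℚ} (hs : s ∈ pIntegers p) {k : ℕ} (hk : k ≤ p) :
    ∏ j ∈ range k, (1 - p * s / j) - (1 - p * s * hBelow ℚ 1 k + p ^ 2 * s ^ 2 * eBelow₂ ℚ k
      - p ^ 3 * s ^ 3 * eBelow₃ ℚ k) ∈ pMultiples p 4 := by
  induction k with
  | zero => simp [hBelow, eBelow₂, eBelow₃, zero_mem]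
  | succ k ih =>
    rw [prod_range_succ, hBelow_succ, eBelow₂_succ, eBelow₃_succ]
    have hk' := inv_natCast_mem (p := p) (k := k) (by omega)
    have h1 : 1 - p * s / (k : ℚ) ∈ pIntegers p :=
      sub_mem (one_mem _) (mul_mem (mul_mem (natCast_mem _ _) hs) hk')
    have h2 := add_mem (mul_mem_pMultiples h1 (ih (by omega)))
      (pow_mul_mem_pMultiples (p := p) (e := 4)
        (mul_mem (mul_mem (pow_mem hs 4) (eBelow₃_mem (p := p) (k := k) (by omega))) hk'))
    convert h2 using 1
    simp only [div_eq_mul_inv, pow_one]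
    ring

lemma prod_one_sub_div_expand_three {k : ℕ} (hk : k ≤ p) :
    ∏ j ∈ range k, (1 - (p : ℚ) / j) - (1 - p * hBelow ℚ 1 k + p ^ 2 * eBelow₂ ℚ k)
      ∈ pMultiples p 3 := by
  have h1 := pMultiples_le (show 3 ≤ 4 by omega)
    (prod_one_sub_div_expand (p := p) (one_mem _) hk)
  have h2 := sub_mem h1 (pow_mul_mem_pMultiples (p := p) (e := 3) (eBelow₃_mem hk))
  simp only [mul_one, one_pow] at h2
  convert h2 using 1
  ring

lemma prod_one_sub_div_expand_two {k : ℕ} (hk : k ≤ p) :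
    ∏ j ∈ range k, (1 - (p : ℚ) / j) - (1 - p * hBelow ℚ 1 k) ∈ pMultiples p 2 := by
  have h1 := pMultiples_le (show 2 ≤ 3 by omega) (prod_one_sub_div_expand_three (p := p) hk)
  have h2 := add_mem h1 (pow_mul_mem_pMultiples (p := p) (e := 2) (eBelow₂_mem hk))
  convert h2 using 1
  ring

lemma neg_one_pow_mul_choose_eq_prod {N k : ℕ} (hk : k < N) :
    (-1 : ℚ) ^ k * ((N - 1).choose k : ℚ) = ∏ j ∈ range (k + 1), (1 - (N : ℚ) / j) := by
  induction k with
  | zero => simp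
  | succ k ih =>
    rw [prod_range_succ, ← ih (by omega)]
    have h := Nat.choose_succ_right_eq (N - 1) k
    have h' : ((N - 1).choose (k + 1) : ℚ) * (k + 1) = (N - 1).choose k * (N - 1 - k) := by
      have : ((N - 1 - k : ℕ) : ℚ) = N - 1 - k := by
        rw [Nat.cast_sub (by omega), Nat.cast_sub (by omega)]; simp
      rw [← this]; exact_mod_cast h
    have hk0 : (k : ℚ) + 1 ≠ 0 := by positivity
    push_cast
    field_simp
    rw [pow_succ]
    linear_combination -(-1) ^ k * h'

lemma natCast_ne_zero_rat {N : ℕ} : ∀ m, 0 < m → m < N → (m : ℚ) ≠ 0 :=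
  fun m hm _ => by exact_mod_cast hm.ne'

lemma sum_one_sub_pow_div (N : ℕ) (hN : 0 < N) (x : ℚ) :
    ∑ m ∈ range N, 1 / (m : ℚ) * (1 - x) ^ m = hBelow ℚ 1 N +
      ∑ k ∈ range N, (∏ j ∈ range (k + 1), (1 - (N : ℚ) / j)) / k * x ^ k := by
  rw [sum_mul_one_sub_pow]
  obtain ⟨n, rfl⟩ : ∃ n, N = n + 1 := ⟨N - 1, by omega⟩
  rw [sum_range_succ', sum_range_succ' (fun k =>
    (∏ j ∈ range (k + 1), (1 - ((n + 1 : ℕ) : ℚ) / j)) / k * x ^ k), binomDual_zero, add_comm]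
  simp only [hBelow, pow_zero, mul_one, pow_one, Nat.cast_zero, div_zero, add_zero]
  congr 1
  refine sum_congr rfl fun k hk => ?_
  rw [mem_range] at hk
  rw [binomDual_inv natCast_ne_zero_rat (by omega) (by omega),
    neg_one_pow_mul_choose_eq_prod (by omega)]

lemma pow_mem_pIntegers_natCast (x : ℤ) (k : ℕ) : ((x : ℚ)) ^ k ∈ pIntegers p :=
  pow_mem (intCast_mem _ _) _

lemma sum_prod_div_expand (x : ℤ) :
    ∑ k ∈ range p, (∏ j ∈ range (k + 1), (1 - (p : ℚ) / j)) / k * (x : ℚ) ^ k -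
      (∑ k ∈ range p, 1 / (k : ℚ) * (x : ℚ) ^ k
        - p * ∑ k ∈ range p, hBelow ℚ 1 (k + 1) / k * (x : ℚ) ^ k
        + p ^ 2 * ∑ k ∈ range p, eBelow₂ ℚ (k + 1) / k * (x : ℚ) ^ k) ∈ pMultiples p 3 := by
  rw [mul_sum, mul_sum, ← sum_sub_distrib, ← sum_add_distrib, ← sum_sub_distrib]
  refine sum_mem fun k hk => ?_
  rw [mem_range] at hk
  have h := mul_mem_pMultiples (mul_mem (inv_natCast_mem hk) (pow_mem_pIntegers_natCast x k))
    (prod_one_sub_div_expand_three (p := p) (k := k + 1) (by omega))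
  convert h using 1
  simp only [div_eq_mul_inv]
  ring

/-- The relation between harmonic sums obtained from `∑ (1 - x) ^ m / m` at `x = 1`. -/
lemma two_mul_hBelow_one_relation :
    2 * hBelow ℚ 1 p - p * ((hBelow ℚ 1 p ^ 2 + hBelow ℚ 2 p) / 2) + p ^ 2 * (eBelow₃ ℚ p +
      ∑ k ∈ range p, hBelow ℚ 1 k / (k : ℚ) ^ 2) ∈ pMultiples p 3 := by
  have h1 := sum_one_sub_pow_div p (Fact.out : p.Prime).pos 1
  have h2 := sum_prod_div_expand (p := p) 1
  -- At x = 1 every power with m > 0 vanishes, and the term m = 0 vanishes because 1/0 = 0.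
  have h0 : ∑ m ∈ range p, 1 / (m : ℚ) * (1 - 1) ^ m = 0 := sum_eq_zero fun m _ => by
    rcases Nat.eq_zero_or_pos m with rfl | h
    · simp
    · rw [sub_self, zero_pow h.ne', mul_zero]
  have e1 : ∑ k ∈ range p, 1 / (k : ℚ) = hBelow ℚ 1 p := by simp [hBelow]
  have e2 : ∑ k ∈ range p, hBelow ℚ 1 (k + 1) / k = eBelow₂ ℚ p + hBelow ℚ 2 p := by
    rw [eBelow₂, hBelow, ← sum_add_distrib]
    exact sum_congr rfl fun k _ => by rw [hBelow_succ]; ring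
  have e3 : ∑ k ∈ range p, eBelow₂ ℚ (k + 1) / k = eBelow₃ ℚ p +
      ∑ k ∈ range p, hBelow ℚ 1 k / (k : ℚ) ^ 2 := by
    rw [eBelow₃, ← sum_add_distrib]
    exact sum_congr rfl fun k _ => by rw [eBelow₂_succ]; ring
  have e4 := two_mul_eBelow₂ (K := ℚ) p
  rw [h0] at h1
  simp only [Int.cast_one, one_pow, mul_one] at h1 h2
  rw [e1, e2, e3] at h2
  convert neg_mem h2 using 1
  linear_combination h1 + p / 2 * e4 - 2 * h1

/-- The relation obtained from `∑ (1 - x) ^ m / m` at `x = 2`. -/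
lemma sum_neg_one_pow_div_relation :
    ∑ k ∈ range p, 1 / (k : ℚ) * (-1) ^ k - (hBelow ℚ 1 p + ∑ k ∈ range p, 1 / (k : ℚ) * 2 ^ k
        - p * ∑ k ∈ range p, hBelow ℚ 1 (k + 1) / k * 2 ^ k
        + p ^ 2 * ∑ k ∈ range p, eBelow₂ ℚ (k + 1) / k * 2 ^ k) ∈ pMultiples p 3 := by
  have h1 := sum_one_sub_pow_div p (Fact.out : p.Prime).pos 2
  have h2 := sum_prod_div_expand (p := p) 2
  rw [show (1 : ℚ) - 2 = -1 by norm_num] at h1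
  push_cast at h2
  rw [h1]
  convert h2 using 1
  ring

/-- The relation obtained from `∑ (1 - x) ^ m / m` at `x = -1`. -/
lemma sum_two_pow_div_relation :
    ∑ k ∈ range p, 1 / (k : ℚ) * 2 ^ k - (hBelow ℚ 1 p - 2 * fermatQuotient p 2
        - p * ∑ k ∈ range p, 1 / (k : ℚ) ^ 2 * (-1) ^ k
        + p ^ 2 * ∑ k ∈ range p, hBelow ℚ 1 k / (k : ℚ) ^ 2 * (-1) ^ k) ∈ pMultiples p 3 := by
  have hp : 0 < p := (Fact.out : p.Prime).pos
  have hp0 := prime_cast_ne_zero (p := p)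
  have h1 := sum_one_sub_pow_div p hp (-1)
  rw [show (1 : ℚ) - -1 = 2 by norm_num] at h1
  have hq : 2 * fermatQuotient p 2 = (∑ k ∈ Ico 1 p, (p.choose k : ℚ)) / p := by
    rw [sum_choose_Ico hp, fermatQuotient]
    have : (2 : ℚ) ^ p = 2 ^ (p - 1) * 2 := by rw [← pow_succ]; congr 1; omega
    rw [this]; push_cast; ring
  -- Splitting off the last factor 1 - p/k leaves C(p-1,k-1)/k = C(p,k)/p, whose sum is exactly 2q.
  -- The rest carries an explicit p, so its product is needed only modulo p^2.
  have h2 : ∑ k ∈ range p, (∏ j ∈ range (k + 1), (1 - (p : ℚ) / j)) / k * (-1) ^ k =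
      -(2 * fermatQuotient p 2) -
        p * ∑ k ∈ range p, (∏ j ∈ range k, (1 - (p : ℚ) / j)) / (k : ℚ) ^ 2 * (-1) ^ k := by
    rw [hq, sum_div, range_eq_Ico, sum_eq_sum_Ico_succ_bot hp, sum_eq_sum_Ico_succ_bot hp]
    simp only [Nat.cast_zero, div_zero, zero_mul, zero_add, ne_eq, OfNat.ofNat_ne_zero,
      not_false_eq_true, zero_pow]
    rw [mul_sum, ← sum_neg_distrib, ← sum_sub_distrib]
    refine sum_congr rfl fun k hk => ?_
    rw [mem_Ico] at hk
    obtain ⟨k, rfl⟩ : ∃ k', k = k' + 1 := ⟨k - 1, by omega⟩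
    have hk0 : ((k + 1 : ℕ) : ℚ) ≠ 0 := by positivity
    have e := choose_div_eq (K := ℚ) (m := p) (k := k + 1) hp0 hk0
    have e1 := neg_one_pow_mul_choose_eq_prod (N := p) (k := k) (by omega)
    have e2 : (-1 : ℚ) ^ k * (-1) ^ k = 1 := by rw [← mul_pow]; simp
    rw [Nat.add_sub_cancel] at e
    rw [← neg_div, prod_range_succ, ← e1, neg_div, e, pow_succ]
    have e3 : ((-1 : ℚ) ^ k * ((p - 1).choose k : ℚ) * (1 - p / ((k + 1 : ℕ) : ℚ)) /
        ((k + 1 : ℕ) : ℚ) * ((-1) ^ k * -1)) =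
        ((-1 : ℚ) ^ k * (-1) ^ k) * (-((p - 1).choose k : ℚ) * (1 - p / ((k + 1 : ℕ) : ℚ)) /
        ((k + 1 : ℕ) : ℚ)) := by ring
    have e4 : (p : ℚ) * ((-1 : ℚ) ^ k * ((p - 1).choose k : ℚ) /
        ((k + 1 : ℕ) : ℚ) ^ 2 * ((-1) ^ k * -1)) = ((-1 : ℚ) ^ k * (-1) ^ k) *
        (-(p * ((p - 1).choose k : ℚ) / ((k + 1 : ℕ) : ℚ) ^ 2)) := by ring
    rw [e3, e4, e2]
    ring
  have h3 : ∑ k ∈ range p, (∏ j ∈ range k, (1 - (p : ℚ) / j)) / (k : ℚ) ^ 2 * (-1 : ℚ) ^ k -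
      (∑ k ∈ range p, 1 / (k : ℚ) ^ 2 * (-1 : ℚ) ^ k -
        p * ∑ k ∈ range p, hBelow ℚ 1 k / (k : ℚ) ^ 2 * (-1 : ℚ) ^ k) ∈ pMultiples p 2 := by
    rw [mul_sum, ← sum_sub_distrib, ← sum_sub_distrib]
    refine sum_mem fun k hk => ?_
    rw [mem_range] at hk
    have h := mul_mem_pMultiples (mul_mem (one_div_natCast_pow_mem hk 2)
      (pow_mem_pIntegers_natCast (-1) k)) (prod_one_sub_div_expand_two (p := p) hk.le)
    convert h using 1
    push_cast
    ring
  rw [h1, h2]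
  convert neg_mem (pow_mul_mem_pMultiples_add (d := 1) h3) using 1
  ring

end Expansions

/-! ### Reversal and half-range sums over the rationals -/

section HalfSums

open Finset

lemma sum_mul_neg_one_pow_odd {K : Type*} [Field K] (n : ℕ) (f : ℕ → K) :
    ∑ k ∈ range (2 * n + 1), f k * (-1) ^ k =
      2 * ∑ j ∈ range (n + 1), f (2 * j) - ∑ k ∈ range (2 * n + 1), f k := by
  induction n with
  | zero => simp; ring
  | succ n ih =>
    have h : 2 * (n + 1) + 1 = 2 * n + 1 + 1 + 1 := by ring
    rw [sum_range_succ (fun j => f (2 * j)) (n + 1), h, sum_range_succ _ (2 * n + 1 + 1),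
      sum_range_succ _ (2 * n + 1), ih, sum_range_succ f (2 * n + 1 + 1),
      sum_range_succ f (2 * n + 1)]
    have e1 : (-1 : K) ^ (2 * n) = 1 := by rw [pow_mul]; simp
    simp only [pow_succ, e1, show 2 * (n + 1) = 2 * n + 1 + 1 by ring]
    ring

lemma sum_neg_one_pow_div_pow {K : Type*} [Field K] (n m : ℕ) :
    ∑ k ∈ range (2 * n + 1), 1 / (k : K) ^ m * (-1) ^ k =
      2 / 2 ^ m * hBelow K m (n + 1) - hBelow K m (2 * n + 1) := by
  rw [sum_mul_neg_one_pow_odd, hBelow, hBelow, mul_sum, mul_sum]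
  congr 1
  refine sum_congr rfl fun j _ => ?_
  push_cast
  rw [mul_pow]
  ring

lemma sum_Ico_one_reflect {A : Type*} [AddCommMonoid A] (f : ℕ → A) (N : ℕ) :
    ∑ k ∈ Ico 1 N, f (N - k) = ∑ k ∈ Ico 1 N, f k := by
  rcases Nat.eq_zero_or_pos N with rfl | h
  · simp
  have := sum_Ico_reflect f 1 (show N ≤ N + 1 by omega)
  simpa using this

lemma sum_Ico_one_half {A : Type*} [AddCommMonoid A] (f : ℕ → A) (n : ℕ) :
    ∑ k ∈ Ico 1 (2 * n + 1), f k = ∑ k ∈ Ico 1 (n + 1), (f k + f (2 * n + 1 - k)) := by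
  rw [sum_add_distrib, ← sum_Ico_consecutive f (show 1 ≤ n + 1 by omega)
    (show n + 1 ≤ 2 * n + 1 by omega)]
  congr 1
  have := sum_Ico_reflect f 1 (show n + 1 ≤ 2 * n + 1 + 1 by omega)
  rw [this]
  congr 2
  omega

variable {p : ℕ} [Fact p.Prime]

lemma natCast_sub_rat {p k : ℕ} (hk : k < p) : ((p - k : ℕ) : ℚ) = p - k := Nat.cast_sub hk.le

lemma inv_prime_sub_expand {k : ℕ} (h0 : 0 < k) (hk : k < p) :
    1 / ((p - k : ℕ) : ℚ) + (1 / (k : ℚ) + p * (1 / (k : ℚ) ^ 2) + p ^ 2 * (1 / (k : ℚ) ^ 3))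
      ∈ pMultiples p 3 := by
  have h1 := mul_mem (one_div_natCast_pow_mem hk 3)
    (one_div_natCast_pow_mem (p := p) (k := p - k) (by omega) 1)
  convert pow_mul_mem_pMultiples (p := p) (e := 3) h1 using 1
  have hk0 : (k : ℚ) ≠ 0 := by exact_mod_cast h0.ne'
  have hk1 : ((p - k : ℕ) : ℚ) ≠ 0 := by exact_mod_cast (by omega : p - k ≠ 0)
  rw [natCast_sub_rat hk] at *
  field_simp
  ring

lemma inv_sq_prime_sub_expand {k : ℕ} (h0 : 0 < k) (hk : k < p) :
    1 / ((p - k : ℕ) : ℚ) ^ 2 - (1 / (k : ℚ) ^ 2 + 2 * p * (1 / (k : ℚ) ^ 3))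
      ∈ pMultiples p 2 := by
  have i3 := one_div_natCast_pow_mem hk 3
  have i2 := one_div_natCast_pow_mem hk 2
  have i1 := one_div_natCast_pow_mem (p := p) (k := p - k) (by omega) 1
  have i2' := one_div_natCast_pow_mem (p := p) (k := p - k) (by omega) 2
  have h1 := sub_mem (mul_mem i2 i2') (mul_mem (add_mem i3 i3) i1)
  convert pow_mul_mem_pMultiples (p := p) (e := 2) h1 using 1
  have hk0 : (k : ℚ) ≠ 0 := by exact_mod_cast h0.ne'
  have hk1 : ((p - k : ℕ) : ℚ) ≠ 0 := by exact_mod_cast (by omega : p - k ≠ 0)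
  rw [natCast_sub_rat hk] at *
  field_simp
  ring

lemma hBelow_eq_sum_Ico (m : ℕ) (hm : 0 < m) {N : ℕ} (hN : 0 < N) :
    hBelow ℚ m N = ∑ k ∈ Ico 1 N, 1 / (k : ℚ) ^ m :=
  (sum_Ico_one_eq_hBelow hm hN).symm

lemma two_mul_hBelow_one_add_mem :
    2 * hBelow ℚ 1 p + p * hBelow ℚ 2 p + p ^ 2 * hBelow ℚ 3 p ∈ pMultiples p 3 := by
  have hp : 0 < p := (Fact.out : p.Prime).pos
  rw [two_mul]
  nth_rewrite 1 [hBelow_eq_sum_Ico 1 one_pos hp]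
  rw [← sum_Ico_one_reflect, hBelow_eq_sum_Ico 1 one_pos hp, hBelow_eq_sum_Ico 2 two_pos hp,
    hBelow_eq_sum_Ico 3 three_pos hp, mul_sum, mul_sum, ← sum_add_distrib, ← sum_add_distrib,
    ← sum_add_distrib]
  refine sum_mem fun k hk => ?_
  rw [mem_Ico] at hk
  convert inv_prime_sub_expand (p := p) hk.1 hk.2 using 1
  ring

/-- Reversal k ↦ p - k flips the sign since p is odd, and 1/(p-k)^2 ≡ 1/k^2 + 2p/k^3 supplies the
correction. The resulting relation carries a factor 2, removed at the end. -/
lemma sum_neg_one_pow_div_sq_mem (h5 : 5 < p) :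
    ∑ k ∈ range p, 1 / (k : ℚ) ^ 2 * (-1 : ℚ) ^ k +
      (p : ℚ) * ∑ k ∈ range p, 1 / (k : ℚ) ^ 3 * (-1 : ℚ) ^ k ∈ pMultiples p 2 := by
  have hp : 0 < p := by omega
  have hodd : Odd p := (Fact.out : p.Prime).odd_of_ne_two (by omega)
  have h : ∀ m, 0 < m → ∑ k ∈ range p, 1 / (k : ℚ) ^ m * (-1 : ℚ) ^ k =
      ∑ k ∈ Ico 1 p, 1 / (k : ℚ) ^ m * (-1 : ℚ) ^ k := by
    intro m hm
    rw [range_eq_Ico, sum_eq_sum_Ico_succ_bot hp]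
    simp [hm.ne']
  have half : (1 / 2 : ℚ) ∈ pIntegers p := by
    have := smooth_mem_pIntegers h5 1 1 0
    norm_num at this; simpa using this
  have key : (2 : ℚ) * ∑ k ∈ range p, 1 / (k : ℚ) ^ 2 * (-1 : ℚ) ^ k +
      2 * ((p : ℚ) * ∑ k ∈ range p, 1 / (k : ℚ) ^ 3 * (-1 : ℚ) ^ k) ∈ pMultiples p 2 := by
    rw [h 2 two_pos, h 3 three_pos, two_mul]
    nth_rewrite 1 [← sum_Ico_one_reflect]
    rw [mul_sum, mul_sum, ← sum_add_distrib, ← sum_add_distrib]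
    refine sum_mem fun k hk => ?_
    rw [mem_Ico] at hk
    have h1 := mul_mem_pMultiples (pow_mem_pIntegers_natCast (-1) k)
      (neg_mem (inv_sq_prime_sub_expand (p := p) hk.1 hk.2))
    convert h1 using 1
    have e1 : (-1 : ℚ) ^ (p - k) * (-1) ^ k = -1 := by
      rw [← pow_add, show p - k + k = p by omega, hodd.neg_one_pow]
    have e2 : (-1 : ℚ) ^ k * (-1) ^ k = 1 := by rw [← mul_pow]; simp
    push_cast
    linear_combination (1 / ((p - k : ℕ) : ℚ) ^ 2) * ((-1) ^ k * e1 - (-1) ^ (p - k) * e2)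
  convert mul_mem_pMultiples half key using 1
  ring

lemma hBelow_two_half_mem {n : ℕ} (hn : p = 2 * n + 1) :
    hBelow ℚ 2 p - 2 * hBelow ℚ 2 (n + 1) - 2 * p * hBelow ℚ 3 (n + 1) ∈ pMultiples p 2 := by
  have hp : 0 < p := (Fact.out : p.Prime).pos
  have e := sum_Ico_one_half (fun k => 1 / (k : ℚ) ^ 2) n
  rw [← hn] at e
  rw [hBelow_eq_sum_Ico 2 two_pos hp, e, hBelow_eq_sum_Ico 2 two_pos (by omega),
    hBelow_eq_sum_Ico 3 three_pos (by omega), mul_sum, mul_sum, ← sum_sub_distrib,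
    ← sum_sub_distrib]
  refine sum_mem fun k hk => ?_
  rw [mem_Ico] at hk
  convert inv_sq_prime_sub_expand (p := p) (k := k) (by omega) (by omega) using 1
  ring

/-- Read in reverse order, the numerators 2j - 2n - 1 are the negatives of the first n odd numbers,
so the product is a central binomial coefficient up to sign and a power of 4. -/
lemma prod_range_succ_one_sub_div (n : ℕ) :
    ∏ j ∈ range (n + 1), (1 - ((2 * n + 1 : ℕ) : ℚ) / (2 * j)) =
      (-1) ^ n * ((2 * n).choose n : ℚ) / 4 ^ n := by
  have h1 : ∀ n : ℕ, ∏ j ∈ range n, ((1 - 2 * ((j : ℚ) + 1)) / (2 * (j + 1))) =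
      (-1) ^ n * ((2 * n).choose n : ℚ) / 4 ^ n := by
    intro n
    induction n with
    | zero => simp
    | succ n ih =>
      have h := Nat.succ_mul_centralBinom_succ n
      rw [Nat.centralBinom_eq_two_mul_choose, Nat.centralBinom_eq_two_mul_choose] at h
      have h' : ((n : ℚ) + 1) * ((2 * (n + 1)).choose (n + 1) : ℚ) =
          2 * (2 * n + 1) * ((2 * n).choose n : ℚ) := by exact_mod_cast h
      have hn0 : (n : ℚ) + 1 ≠ 0 := by positivity
      rw [prod_range_succ, ih, pow_succ, pow_succ]
      field_simp
      linear_combination 2 * h'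
  rw [← h1 n, prod_range_succ', prod_div_distrib]
  have h2 : ∏ j ∈ range n, (1 - 2 * ((j : ℚ) + 1)) =
      ∏ j ∈ range n, (2 * ((j : ℚ) + 1) - (2 * n + 1)) := by
    rw [← prod_range_reflect]
    refine prod_congr rfl fun j hj => ?_
    rw [mem_range] at hj
    rw [show n - 1 - j = n - (j + 1) by omega, Nat.cast_sub (by omega)]
    push_cast; ring
  rw [h2, ← prod_div_distrib]
  simp only [Nat.cast_zero, mul_zero, div_zero, sub_zero, mul_one]
  refine prod_congr rfl fun j _ => ?_
  have : (j : ℚ) + 1 ≠ 0 := by positivity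
  push_cast
  field_simp

/-- Both sides equal (-1)^n C(2n,n). For p = 2n + 1 the power of 2 is 2^(p-1) = 1 + pq, which is how
the Fermat quotient enters the half-range harmonic number. -/
lemma prod_one_sub_div_half (n : ℕ) :
    ∏ j ∈ range (n + 1), (1 - ((2 * n + 1 : ℕ) : ℚ) / j) =
      2 ^ (2 * n) * ∏ j ∈ range (n + 1), (1 - ((2 * n + 1 : ℕ) : ℚ) / (2 * j)) := by
  rw [prod_range_succ_one_sub_div, ← neg_one_pow_mul_choose_eq_prod (by omega),
    Nat.add_sub_cancel, pow_mul]
  norm_num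
  field_simp

end HalfSums

/-! ### Power sums modulo powers of p and Lehmer's congruence -/

section Lehmer

open Finset

variable {p : ℕ} [Fact p.Prime]

lemma fermatQuotient_two_mem (h5 : 5 < p) : fermatQuotient p 2 ∈ pIntegers p := by
  have h := (((Reduces.ofNat (p := p) 2).pow (p - 1)).sub Reduces.one).congr_right (y' := 0)
    (by rw [ZMod.pow_card_sub_one_eq_one (two_ne_zero_zmod h5), sub_self])
  obtain ⟨c, hc, h⟩ := h.exists_eq_mul
  have : fermatQuotient p 2 = c := by
    rw [fermatQuotient]
    push_cast
    rw [h, mul_div_cancel_left₀ _ prime_cast_ne_zero]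
  rwa [this]

lemma two_pow_eq_fermatQuotient : (2 : ℚ) ^ (p - 1) = 1 + p * fermatQuotient p 2 := by
  rw [fermatQuotient, mul_div_cancel₀ _ prime_cast_ne_zero]
  push_cast; ring

/-- The power sums over the half range satisfy `∑ 1 / k ^ 2 ≡ -7 / 6 p ∑ 1 / k ^ 3`. -/
lemma hBelow_two_half_relation (h5 : 5 < p) {n : ℕ} (hn : p = 2 * n + 1) :
    hBelow ℚ 2 (n + 1) + 7 / 6 * p * hBelow ℚ 3 (n + 1) ∈ pMultiples p 2 := by
  have hA := sum_neg_one_pow_div_sq_mem (p := p) h5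
  have hH := hBelow_two_half_mem (p := p) hn
  have h3 : hBelow ℚ 3 p ∈ pMultiples p 1 := ((Reduces.hBelow 3 le_rfl).congr_right
    (hBelow_zmod_self (by omega))).mem_pMultiples_one
  have h3' := pow_mul_mem_pMultiples_add (d := 1) h3
  have e2 : ∑ k ∈ range p, 1 / (k : ℚ) ^ 2 * (-1 : ℚ) ^ k =
      2 / 2 ^ 2 * hBelow ℚ 2 (n + 1) - hBelow ℚ 2 p := by
    rw [hn]; exact sum_neg_one_pow_div_pow n 2
  have e3 : ∑ k ∈ range p, 1 / (k : ℚ) ^ 3 * (-1 : ℚ) ^ k =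
      2 / 2 ^ 3 * hBelow ℚ 3 (n + 1) - hBelow ℚ 3 p := by
    rw [hn]; exact sum_neg_one_pow_div_pow n 3
  rw [e2, e3] at hA
  -- With h₂ and u the half-range sums of orders 2 and 3, the added relations leave -(3/2)h₂ -
  -- (7/4)pu. Multiplying by -2/3 gives h₂ + (7/6)pu.
  convert mul_mem_pMultiples (smooth_mem_pIntegers h5 (-2) 0 1) (add_mem (add_mem hA hH) h3')
    using 1
  push_cast
  ring

lemma hBelow_two_relation (h5 : 5 < p) {n : ℕ} (hn : p = 2 * n + 1) :
    hBelow ℚ 2 p + 1 / 3 * p * hBelow ℚ 3 (n + 1) ∈ pMultiples p 2 := by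
  convert add_mem (hBelow_two_half_mem (p := p) hn) (mul_mem_pMultiples
    (natCast_mem _ 2) (hBelow_two_half_relation h5 hn)) using 1
  push_cast
  ring

lemma hBelow_one_relation (h5 : 5 < p) {n : ℕ} (hn : p = 2 * n + 1) :
    hBelow ℚ 1 p - 1 / 6 * p ^ 2 * hBelow ℚ 3 (n + 1) ∈ pMultiples p 3 := by
  have h3 : hBelow ℚ 3 p ∈ pMultiples p 1 := ((Reduces.hBelow 3 le_rfl).congr_right
    (hBelow_zmod_self (by omega))).mem_pMultiples_one
  convert mul_mem_pMultiples (smooth_mem_pIntegers h5 1 1 0) (sub_mem (sub_mem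
    (two_mul_hBelow_one_add_mem (p := p))
    (pow_mul_mem_pMultiples_add (d := 1) (hBelow_two_relation h5 hn)))
    (pow_mul_mem_pMultiples_add (d := 2) h3)) using 1
  push_cast
  ring

/-- Two evaluations of H_{p-1} meet: reversal gives p^2 u/6, and duality at x = 1 gives a relation
involving κ. Inserting H_{p-1,2} ≡ -pu/3 leaves p^2(u/2 + κ) ≡ 0 modulo p^3. -/
lemma hBelow_three_half_relation (h5 : 5 < p) {n : ℕ} (hn : p = 2 * n + 1) :
    hBelow ℚ 3 (n + 1) + 2 * ∑ k ∈ range p, hBelow ℚ 1 k / (k : ℚ) ^ 2 ∈ pMultiples p 1 := by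
  have h1 : hBelow ℚ 1 p ∈ pMultiples p 1 := ((Reduces.hBelow 1 le_rfl).congr_right
    (hBelow_zmod_self (by omega))).mem_pMultiples_one
  have e3 : eBelow₃ ℚ p ∈ pMultiples p 1 := by
    have h3 : hBelow ℚ 3 p ∈ pMultiples p 1 := ((Reduces.hBelow 3 le_rfl).congr_right
      (hBelow_zmod_self (by omega))).mem_pMultiples_one
    have h2 := hBelow_mem (p := p) 2 le_rfl
    have h1' := hBelow_mem (p := p) 1 le_rfl
    convert mul_mem_pMultiples (smooth_mem_pIntegers h5 1 1 1) (add_mem (mul_mem_pMultiples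
      (sub_mem (pow_mem h1' 2) (mul_mem (natCast_mem _ 3) h2)) h1)
      (mul_mem_pMultiples (natCast_mem _ 2) h3)) using 1
    have := six_mul_eBelow₃ (K := ℚ) p
    push_cast
    linear_combination this / 6
  have hR := two_mul_hBelow_one_relation (p := p)
  have hC := mul_mem_pMultiples (natCast_mem _ 2) (hBelow_one_relation h5 hn)
  have half := smooth_mem_pIntegers h5 1 1 0
  have hD := mul_mem_pMultiples half
    (pow_mul_mem_pMultiples_add (d := 1) (hBelow_two_relation h5 hn))
  have hS := mul_mem_pMultiples half
    (pow_mul_mem_pMultiples_add (d := 1) (mul_mem_pMultiples_add h1 h1))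
  have hE := pow_mul_mem_pMultiples_add (d := 2) e3
  refine pMultiples_cancel (d := 2) ?_
  convert mul_mem_pMultiples (natCast_mem _ 2)
    (sub_mem (add_mem (add_mem (sub_mem hR hC) hD) hS) hE) using 1
  push_cast
  ring

/-- Lehmer's congruence for the harmonic number of index `(p - 1) / 2`, modulo `p ^ 3`. -/
lemma hBelow_one_half_relation (h5 : 5 < p) {n : ℕ} (hn : p = 2 * n + 1) :
    hBelow ℚ 1 (n + 1) - (-2 * fermatQuotient p 2 + p * fermatQuotient p 2 ^ 2 -
      2 / 3 * p ^ 2 * fermatQuotient p 2 ^ 3 + 7 / 24 * p ^ 2 * hBelow ℚ 3 (n + 1))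
      ∈ pMultiples p 3 := by
  have half := smooth_mem_pIntegers h5 1 1 0
  have hpq := two_pow_eq_fermatQuotient (p := p)
  have X1 := prod_one_sub_div_expand (p := p) (one_mem _) (show n + 1 ≤ p by omega)
  have X2 := prod_one_sub_div_expand (p := p) half (show n + 1 ≤ p by omega)
  have hprod := prod_one_sub_div_half n
  have hq := fermatQuotient_two_mem h5
  have hu := hBelow_mem (p := p) 3 (show n + 1 ≤ p by omega)
  have he1 := hBelow_mem (p := p) 1 (show n + 1 ≤ p by omega)
  have he3 := eBelow₃_mem (p := p) (show n + 1 ≤ p by omega)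
  have hh2 := hBelow_two_half_relation h5 hn
  have E2 := two_mul_eBelow₂ (K := ℚ) (n + 1)
  have E3 := six_mul_eBelow₃ (K := ℚ) (n + 1)
  rw [show 2 * n = p - 1 by omega, hpq, ← show p = p - 1 + 1 by omega] at hprod
  have c6 := smooth_mem_pIntegers h5 7 1 1
  have hp := natCast_mem (pIntegers p) p
  set q := fermatQuotient p 2
  set u := hBelow ℚ 3 (n + 1)
  set e₁ := hBelow ℚ 1 (n + 1)
  set e₂ := eBelow₂ ℚ (n + 1)
  set e₃ := eBelow₃ ℚ (n + 1)
  set h₂ := hBelow ℚ 2 (n + 1)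
  have hprod' : ∏ j ∈ range (n + 1), (1 - (p : ℚ) * 1 / j) =
      (1 + p * q) * ∏ j ∈ range (n + 1), (1 - p * (((1 : ℤ) : ℚ) / (2 ^ 1 * 3 ^ 0)) / j) := by
    simp only [mul_one]
    rw [hprod]
    congr 1
    exact prod_congr rfl fun j _ => by push_cast; ring
  -- Expanding both products modulo p^4 and cancelling one p leaves a relation modulo p^3.
  have hM : q + e₁ / 2 - 3 / 4 * p * e₂ + 7 / 8 * p ^ 2 * e₃ - p * q * e₁ / 2 +
      p ^ 2 * q * e₂ / 4 - p ^ 3 * q * e₃ / 8 ∈ pMultiples p 3 := by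
    refine pMultiples_cancel (d := 1) ?_
    convert sub_mem X1 (mul_mem_pMultiples (add_mem (one_mem _) (mul_mem hp hq)) X2) using 1
    rw [hprod']
    push_cast
    ring
  have hh2' : h₂ ∈ pMultiples p 1 := by
    have := pow_mul_mem_pMultiples (p := p) (e := 1) (mul_mem c6 hu)
    convert sub_mem (pMultiples_le (show 1 ≤ 2 by omega) hh2) this using 1
    push_cast; ring
  have t1 := pow_mul_mem_pMultiples_add (d := 1)
    (mul_mem_pMultiples (smooth_mem_pIntegers h5 3 2 0) hh2)
  have t2 := pow_mul_mem_pMultiples_add (d := 2) (mul_mem_pMultiples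
    (add_mem (mul_mem (smooth_mem_pIntegers h5 7 3 0) he1)
      (mul_mem (smooth_mem_pIntegers h5 1 2 0) hq)) hh2')
  have t3 := pow_mul_mem_pMultiples (p := p) (e := 3)
    (mul_mem (smooth_mem_pIntegers h5 1 2 0) (mul_mem hq he3))
  -- Newton's identities and the congruence for h₂ eliminate e₂, e₃ and h₂, leaving a cubic equation
  -- for e₁ modulo p^3 with coefficients in p, q and u.
  have hF : e₁ + 2 * q - 3 / 4 * p * e₁ ^ 2 + 7 / 24 * p ^ 2 * e₁ ^ 3 - p * q * e₁ +
      p ^ 2 * q * e₁ ^ 2 / 4 - 7 / 24 * p ^ 2 * u ∈ pMultiples p 3 := by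
    convert add_mem (add_mem (sub_mem (mul_mem_pMultiples (natCast_mem _ 2) hM) t1) t2) t3 using 1
    push_cast
    linear_combination (-3 / 4 * p + p ^ 2 * q / 4) * (-E2) - 7 / 24 * p ^ 2 * E3
  have hw₀ : -2 / 3 * q ^ 3 + 7 / 24 * u ∈ pIntegers p := by
    convert add_mem (mul_mem (smooth_mem_pIntegers h5 (-2) 0 1) (pow_mem hq 3))
      (mul_mem (smooth_mem_pIntegers h5 7 3 1) hu) using 1
    push_cast; ring
  obtain ⟨w, hw, hw'⟩ : ∃ w ∈ pIntegers p, w = -2 / 3 * q ^ 3 + 7 / 24 * u := ⟨_, hw₀, rfl⟩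
  obtain ⟨y, hy, hy'⟩ : ∃ y ∈ pIntegers p, y = q ^ 2 + p * w :=
    ⟨_, add_mem (pow_mem hq 2) (mul_mem hp hw), rfl⟩
  -- The candidate root x = -2q + pq^2 + p^2 w is kept in nested form, so that the powers of p stay
  -- visible when it is substituted into the cubic.
  obtain ⟨x, hx, hx'⟩ : ∃ x ∈ pIntegers p, x = -2 * q + p * y :=
    ⟨_, add_mem (mul_mem (neg_mem (natCast_mem _ 2)) hq) (mul_mem hp hy), by push_cast; rfl⟩
  have hG : x + 2 * q - 3 / 4 * p * x ^ 2 + 7 / 24 * p ^ 2 * x ^ 3 - p * q * x +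
      p ^ 2 * q * x ^ 2 / 4 - 7 / 24 * p ^ 2 * u ∈ pMultiples p 3 := by
    have hc := add_mem (add_mem (add_mem (add_mem (mul_mem (natCast_mem _ 2) (mul_mem hq hw))
      (mul_mem (smooth_mem_pIntegers h5 (-3) 2 0) (pow_mem hy 2)))
      (mul_mem (smooth_mem_pIntegers h5 5 1 0) (mul_mem (pow_mem hq 2) hy)))
      (mul_mem (smooth_mem_pIntegers h5 (-3) 1 0) (mul_mem hp (mul_mem hq (pow_mem hy 2)))))
      (mul_mem (smooth_mem_pIntegers h5 7 3 1) (mul_mem (pow_mem hp 2) (pow_mem hy 3)))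
    convert pow_mul_mem_pMultiples (p := p) (e := 3) hc using 1
    rw [hx']
    push_cast
    linear_combination (p + 2 * p ^ 2 * q) * hy' + p ^ 2 * hw'
  -- A Hensel argument: subtracting the equations for e₁ and x gives (e₁ - x)(1 + pW) ≡ 0 with W
  -- p-integral, and the second factor is a unit.
  have hδ : e₁ - x ∈ pMultiples p 3 := by
    have s := add_mem he1 hx
    have hW := add_mem (sub_mem (mul_mem (smooth_mem_pIntegers h5 (-3) 2 0) s) hq)
      (mul_mem hp (add_mem (mul_mem (smooth_mem_pIntegers h5 7 3 1)
        (add_mem (add_mem (pow_mem he1 2) (mul_mem he1 hx)) (pow_mem hx 2)))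
        (mul_mem (smooth_mem_pIntegers h5 1 2 0) (mul_mem hq s))))
    refine mem_pMultiples_of_add_mul (sub_mem he1 hx) hW ?_
    convert sub_mem hF hG using 1
    push_cast
    ring
  convert hδ using 1
  rw [hx', hy', hw']
  ring

end Lehmer

/-! ### Assembling the congruences -/

section Assembly

open Finset

lemma harmonic_eq_hBelow (k : ℕ) : harmonic k = hBelow ℚ 1 (k + 1) := by
  rw [harmonic, hBelow, sum_range_succ']
  simp

lemma harmonicOrd_eq_hBelow (k : ℕ) {m : ℕ} (hm : 0 < m) :
    harmonicOrd k m = hBelow ℚ m (k + 1) := by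
  rw [hBelow_eq_sum_Ico m hm (by omega), harmonicOrd]
  rfl

lemma sum_Icc_one_eq_sum_range {A : Type*} [AddCommMonoid A] {p : ℕ} (hp : 0 < p) {f : ℕ → A}
    (h0 : f 0 = 0) : ∑ k ∈ Icc 1 (p - 1), f k = ∑ k ∈ range p, f k := by
  rw [range_eq_Ico, sum_eq_sum_Ico_succ_bot hp, h0, zero_add]
  refine sum_congr ?_ fun _ _ => rfl
  ext k; simp; omega

variable {p : ℕ} [Fact p.Prime]

lemma reduces_sum_neg_one_pow_div (m : ℕ) :
    Reduces p (∑ k ∈ range p, 1 / (k : ℚ) ^ m * (-1 : ℚ) ^ k)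
      (∑ k ∈ range p, 1 / (k : ZMod p) ^ m * (-1) ^ k) :=
  Reduces.sum fun k hk => (Reduces.one.div_natCast_pow (by simpa using hk) m).mul
    (Reduces.one.neg.pow k)

lemma reduces_sum_hBelow_div_sq :
    Reduces p (∑ k ∈ range p, hBelow ℚ 1 k / (k : ℚ) ^ 2)
      (∑ k ∈ range p, hBelow (ZMod p) 1 k / (k : ZMod p) ^ 2) :=
  Reduces.sum fun k hk => by
    rw [mem_range] at hk
    exact (Reduces.hBelow 1 hk.le).div_natCast_pow hk 2

lemma exists_eq_two_mul_add_one (h5 : 5 < p) : ∃ n, p = 2 * n + 1 :=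
  (Fact.out : p.Prime).odd_of_ne_two (by omega)

/-- Separating even indices gives a ≡ u/4, since the full sum of order 3 vanishes modulo p, and u ≡
-2κ. -/
lemma two_mul_sum_neg_one_pow_div_cube (h5 : 5 < p) :
    2 * ∑ k ∈ range p, 1 / (k : ZMod p) ^ 3 * (-1) ^ k =
      -∑ k ∈ range p, hBelow (ZMod p) 1 k / (k : ZMod p) ^ 2 := by
  obtain ⟨n, hn⟩ := exists_eq_two_mul_add_one h5
  have e3 : ∑ k ∈ range p, 1 / (k : ℚ) ^ 3 * (-1 : ℚ) ^ k =
      2 / 2 ^ 3 * hBelow ℚ 3 (n + 1) - hBelow ℚ 3 p := by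
    rw [hn]; exact sum_neg_one_pow_div_pow n 3
  have h3 : hBelow ℚ 3 p ∈ pMultiples p 1 := ((Reduces.hBelow 3 le_rfl).congr_right
    (hBelow_zmod_self (by omega))).mem_pMultiples_one
  have h1 : (2 : ℚ) * ∑ k ∈ range p, 1 / (k : ℚ) ^ 3 * (-1 : ℚ) ^ k +
      ∑ k ∈ range p, hBelow ℚ 1 k / (k : ℚ) ^ 2 ∈ pMultiples p 1 := by
    convert sub_mem (mul_mem_pMultiples (smooth_mem_pIntegers h5 1 1 0)
      (hBelow_three_half_relation h5 hn)) (mul_mem_pMultiples (natCast_mem _ 2) h3) using 1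
    rw [e3]; push_cast; ring
  have h2 := (((Reduces.ofNat 2).mul (reduces_sum_neg_one_pow_div (p := p) 3)).add
    reduces_sum_hBelow_div_sq).2
  rw [(Reduces.of_mem_pMultiples_one h1).2] at h2
  linear_combination -h2

lemma sum_two_pow_div_zmod (h5 : 5 < p) :
    ∑ k ∈ range p, 1 / (k : ZMod p) * 2 ^ k = -2 * (fermatQuotient p 2 : ZMod p) := by
  have hq := fermatQuotient_two_mem h5
  have h1 : hBelow ℚ 1 p ∈ pMultiples p 1 := ((Reduces.hBelow 1 le_rfl).congr_right
    (hBelow_zmod_self (by omega))).mem_pMultiples_one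
  have hP : ∑ k ∈ range p, hBelow ℚ 1 k / (k : ℚ) ^ 2 * (-1 : ℚ) ^ k ∈ pIntegers p :=
    sum_mem fun k hk => by
      rw [mem_range] at hk
      exact (((Reduces.hBelow 1 hk.le).div_natCast_pow hk 2).mul (Reduces.one.neg.pow k)).1
  have h2 := sub_mem (pow_mul_mem_pMultiples (p := p) (e := 1)
    (mul_mem (natCast_mem _ p) hP)) (pow_mul_mem_pMultiples (p := p) (e := 1)
    (reduces_sum_neg_one_pow_div (p := p) 2).1)
  have h3 : ∑ k ∈ range p, 1 / (k : ℚ) * 2 ^ k + 2 * fermatQuotient p 2 ∈ pMultiples p 1 := by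
    convert add_mem (add_mem (pMultiples_le (show 1 ≤ 3 by omega)
      (sum_two_pow_div_relation (p := p))) h1) h2 using 1
    ring
  have h4 : Reduces p (∑ k ∈ range p, 1 / (k : ℚ) * 2 ^ k)
      (∑ k ∈ range p, 1 / (k : ZMod p) * 2 ^ k) :=
    Reduces.sum fun k hk => (Reduces.one.div_natCast (by simpa using hk)).mul
      ((Reduces.ofNat 2).pow k)
  have h5 := (h4.add ((Reduces.ofNat 2).mul (Reduces.of_mem hq))).2
  rw [(Reduces.of_mem_pMultiples_one h3).2] at h5
  linear_combination -h5

/-- The weight three contribution to the congruence modulo `p ^ 2`. -/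
lemma sum_weight_three_mem (h5 : 5 < p) :
    ∑ k ∈ range p, hBelow ℚ 1 k / (k : ℚ) ^ 2 * (-1 : ℚ) ^ k +
      ∑ k ∈ range p, eBelow₂ ℚ (k + 1) / k * 2 ^ k -
      ∑ k ∈ range p, hBelow ℚ 1 k / (k : ℚ) ^ 2 ∈ pMultiples p 1 := by
  have hP : Reduces p (∑ k ∈ range p, hBelow ℚ 1 k / (k : ℚ) ^ 2 * (-1 : ℚ) ^ k)
      (∑ k ∈ range p, hBelow (ZMod p) 1 k / (k : ZMod p) ^ 2 * (-1) ^ k) :=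
    Reduces.sum fun k hk => by
      rw [mem_range] at hk
      exact ((Reduces.hBelow 1 hk.le).div_natCast_pow hk 2).mul (Reduces.one.neg.pow k)
  have hE : Reduces p (∑ k ∈ range p, eBelow₂ ℚ (k + 1) / k * 2 ^ k)
      (∑ k ∈ range p, eBelow₂ (ZMod p) (k + 1) / k * 2 ^ k) :=
    Reduces.sum fun k hk => by
      rw [mem_range] at hk
      exact ((Reduces.eBelow₂ hk).div_natCast hk).mul ((Reduces.ofNat 2).pow k)
  have e : ∑ k ∈ range p, eBelow₂ (ZMod p) (k + 1) / k * 2 ^ k =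
      ∑ k ∈ range p, eBelow₂ (ZMod p) k / k * 2 ^ k +
        ∑ k ∈ range p, hBelow (ZMod p) 1 k / (k : ZMod p) ^ 2 * 2 ^ k := by
    rw [← sum_add_distrib]
    exact sum_congr rfl fun k _ => by rw [eBelow₂_succ]; ring
  have h := (((Reduces.ofNat 2).mul ((hP.add hE).sub
    (reduces_sum_hBelow_div_sq (p := p)))).congr_right (y' := 0) (by
      rw [e, sum_eBelow₂_div_two_pow h5]
      linear_combination two_mul_sum_hBelow_one_div_sq h5 +
        two_mul_sum_hBelow_one_div_sq_two_pow h5)).mem_pMultiples_one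
  convert mul_mem_pMultiples (smooth_mem_pIntegers h5 1 1 0) h using 1
  push_cast; ring

lemma sum_two_pow_mul_harmonic_div_relation (h5 : 5 < p) :
    ∑ k ∈ range p, hBelow ℚ 1 (k + 1) / k * 2 ^ k - (-fermatQuotient p 2 ^ 2 +
      2 / 3 * p * fermatQuotient p 2 ^ 3 + p / 12 * bernoulli (p - 3)) ∈ pMultiples p 2 := by
  obtain ⟨n, hn⟩ := exists_eq_two_mul_add_one h5
  have e1 : ∑ k ∈ range p, 1 / (k : ℚ) * (-1 : ℚ) ^ k =
      hBelow ℚ 1 (n + 1) - hBelow ℚ 1 p := by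
    have := sum_neg_one_pow_div_pow (K := ℚ) n 1
    rw [← hn] at this
    simpa using this
  have e2 : ∑ k ∈ range p, 1 / (k : ℚ) ^ 2 * (-1 : ℚ) ^ k =
      2 / 2 ^ 2 * hBelow ℚ 2 (n + 1) - hBelow ℚ 2 p := by
    rw [hn]; exact sum_neg_one_pow_div_pow n 2
  have R2 := sum_neg_one_pow_div_relation (p := p)
  have R3 := sum_two_pow_div_relation (p := p)
  rw [e1] at R2
  rw [e2] at R3
  have C1 := hBelow_two_half_relation h5 hn
  have C2 := hBelow_two_relation h5 hn
  have C3 := mul_mem_pMultiples (natCast_mem _ 3) (hBelow_one_relation h5 hn)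
  have L := hBelow_one_half_relation h5 hn
  have W := pow_mul_mem_pMultiples_add (d := 2) (sum_weight_three_mem h5)
  -- The coefficient of p^2 u is 1/2 from 3H_{p-1}, -7/24 from Lehmer's congruence and 1/4 from the
  -- alternating sum of order 2, in total 11/24. With u ≡ -2κ and the κ from weight three this
  -- leaves κ/12, which becomes B_{p-3}/12.
  have U := pow_mul_mem_pMultiples_add (d := 2) (mul_mem_pMultiples
    (smooth_mem_pIntegers h5 11 3 1) (hBelow_three_half_relation h5 hn))
  have hB := bernoulli_mem_pIntegers (p := p) (n := p - 3) (by omega)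
  have B := pow_mul_mem_pMultiples_add (d := 2) (mul_mem_pMultiples
    (smooth_mem_pIntegers h5 1 2 1) ((reduces_sum_hBelow_div_sq.sub
      (Reduces.of_mem hB)).congr_right (by
        rw [sum_hBelow_div_sq_eq_bernoulli h5, sub_self])).mem_pMultiples_one)
  have C := pow_mul_mem_pMultiples_add (d := 1) (sub_mem C2 (mul_mem_pMultiples
    (smooth_mem_pIntegers h5 1 1 0) C1))
  refine pMultiples_cancel (d := 1) ?_
  convert add_mem (add_mem (add_mem (add_mem (sub_mem (add_mem (add_mem R2 R3) C3) L) C) W) U) B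
    using 1
  push_cast
  ring

/-- Since p > 5, the factor 2^b 3^c is a unit, so denominators can be cleared and the comparison
made in `ZMod p`. -/
lemma RatModEq.of_const_mul {x y : ℚ} (h5 : 5 < p) (b c : ℕ) {z : ZMod p}
    (hx : Reduces p (2 ^ b * 3 ^ c * x) z) (hy : Reduces p (2 ^ b * 3 ^ c * y) z) :
    RatModEq p x y := by
  have h := mul_mem_pMultiples (smooth_mem_pIntegers h5 1 b c)
    ((hx.sub hy).congr_right (sub_self z)).mem_pMultiples_one
  obtain ⟨d, hd, h⟩ := h
  have := ratModEq_of_eq (e := 1) (x := x) (y := y) hd (by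
    rw [← h]; push_cast; field_simp)
  simpa using this

end Assembly

theorem theorem1p1 (p : ℕ) (hp : p.Prime) (hp5 : 5 < p) :
    RatModEq (p ^ 2)
      (∑ k ∈ Finset.Icc 1 (p - 1), (2 : ℚ) ^ k * harmonic k / (k : ℚ))
      (-(fermatQuotient p 2) ^ 2 + 2 / 3 * (p : ℚ) * (fermatQuotient p 2) ^ 3
        + (p : ℚ) / 12 * bernoulli (p - 3)) ∧
    RatModEq p
      (∑ k ∈ Finset.Icc 1 (p - 1), (2 : ℚ) ^ k * harmonic k / (k : ℚ) ^ 2)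
      (-(1 / 3) * (fermatQuotient p 2) ^ 3 + 23 / 24 * bernoulli (p - 3)) ∧
    RatModEq p
      (∑ k ∈ Finset.Icc 1 (p - 1), harmonic k / ((k : ℚ) ^ 2 * (2 : ℚ) ^ k))
      (5 / 8 * bernoulli (p - 3)) ∧
    RatModEq p
      (∑ k ∈ Finset.Icc 1 (p - 1), (2 : ℚ) ^ k * (harmonic k) ^ 2 / (k : ℚ))
      (-(1 / 3) * (fermatQuotient p 2) ^ 3 + 11 / 24 * bernoulli (p - 3)) ∧
    RatModEq p
      (∑ k ∈ Finset.Icc 1 (p - 1), (harmonic k) ^ 2 / ((k : ℚ) * (2 : ℚ) ^ k))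
      (7 / 8 * bernoulli (p - 3)) ∧
    RatModEq p
      (∑ k ∈ Finset.Icc 1 (p - 1), (2 : ℚ) ^ k * harmonicOrd k 2 / (k : ℚ))
      (-(1 / 3) * (fermatQuotient p 2) ^ 3 - 25 / 24 * bernoulli (p - 3)) := by
  have : Fact p.Prime := ⟨hp⟩
  have hp0 : 0 < p := hp.pos
  have hL := sum_two_pow_div_zmod hp5
  have hκ := sum_hBelow_div_sq_eq_bernoulli hp5
  have ha := two_mul_sum_neg_one_pow_div_cube hp5
  rw [hκ] at ha
  have hq := Reduces.of_mem (fermatQuotient_two_mem hp5)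
  have hB := Reduces.of_mem (bernoulli_mem_pIntegers (p := p) (n := p - 3) (by omega))
  have two : ∀ k, Reduces p ((2 : ℚ) ^ k) (2 ^ k) := fun k => (Reduces.ofNat 2).pow k
  have invTwo : ∀ k : ℕ, Reduces p ((2 : ℚ) ^ k)⁻¹ ((2 : ZMod p) ^ k)⁻¹ := fun k => by
    rw [← inv_pow, ← inv_pow]
    exact_mod_cast (Reduces.inv_natCast (p := p) (k := 2) (by omega)).pow k
  have mul24 : ∀ {x : ℚ} {z : ZMod p}, Reduces p x z → Reduces p (2 ^ 3 * 3 ^ 1 * x) (24 * z) :=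
    fun h => by
      have := (Reduces.ofNat (p := p) 24).mul h
      norm_num at this ⊢
      exact this
  have mul8 : ∀ {x : ℚ} {z : ZMod p}, Reduces p x z → Reduces p (2 ^ 3 * 3 ^ 0 * x) (8 * z) :=
    fun h => by
      have := (Reduces.ofNat (p := p) 8).mul h
      norm_num at this ⊢
      exact this
  have rhs := ((Reduces.ofNat (p := p) 8).neg.mul (hq.pow 3))
  refine ⟨?_, ?_, ?_, ?_, ?_, ?_⟩
  · obtain ⟨c, hc, h⟩ := sum_two_pow_mul_harmonic_div_relation hp5
    refine ratModEq_of_eq hc ?_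
    rw [← h, sum_Icc_one_eq_sum_range hp0 (by simp)]
    simp only [harmonic_eq_hBelow]
    congr 1
    exact Finset.sum_congr rfl fun k _ => by ring
  · rw [sum_Icc_one_eq_sum_range hp0 (by simp)]
    simp only [harmonic_eq_hBelow]
    refine RatModEq.of_const_mul hp5 3 1 (mul24 (Reduces.sum
      (g := fun k => 2 ^ k * hBelow (ZMod p) 1 (k + 1) / (k : ZMod p) ^ 2) fun k hk => ?_)) ?_
    · rw [Finset.mem_range] at hk
      exact ((two k).mul (Reduces.hBelow 1 hk)).div_natCast_pow hk 2
    · rw [sum_two_pow_mul_harmonic_div_sq hp5 hL hκ ha]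
      convert rhs.add ((Reduces.ofNat 23).mul hB) using 1
      ring
  · rw [sum_Icc_one_eq_sum_range hp0 (by simp)]
    simp only [harmonic_eq_hBelow]
    refine RatModEq.of_const_mul hp5 3 0 (mul8 (Reduces.sum
      (g := fun k => hBelow (ZMod p) 1 (k + 1) / ((k : ZMod p) ^ 2 * 2 ^ k)) fun k hk => ?_)) ?_
    · rw [Finset.mem_range] at hk
      rw [← div_div, ← div_div, div_eq_mul_inv _ ((2 : ℚ) ^ k),
        div_eq_mul_inv _ ((2 : ZMod p) ^ k)]
      exact ((Reduces.hBelow 1 hk).div_natCast_pow hk 2).mul (invTwo k)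
    · rw [sum_harmonic_div_sq_mul_two_pow hp5 hκ ha]
      convert (Reduces.ofNat 5).mul hB using 1
      ring
  · rw [sum_Icc_one_eq_sum_range hp0 (by simp)]
    simp only [harmonic_eq_hBelow]
    refine RatModEq.of_const_mul hp5 3 1 (mul24 (Reduces.sum
      (g := fun k => 2 ^ k * hBelow (ZMod p) 1 (k + 1) ^ 2 / (k : ZMod p)) fun k hk => ?_)) ?_
    · rw [Finset.mem_range] at hk
      exact ((two k).mul ((Reduces.hBelow 1 hk).pow 2)).div_natCast hk
    · rw [sum_two_pow_mul_harmonic_sq_div hp5 hL hκ ha]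
      convert rhs.add ((Reduces.ofNat 11).mul hB) using 1
      ring
  · rw [sum_Icc_one_eq_sum_range hp0 (by simp)]
    simp only [harmonic_eq_hBelow]
    refine RatModEq.of_const_mul hp5 3 0 (mul8 (Reduces.sum
      (g := fun k => hBelow (ZMod p) 1 (k + 1) ^ 2 / ((k : ZMod p) * 2 ^ k)) fun k hk => ?_)) ?_
    · rw [Finset.mem_range] at hk
      rw [← div_div, ← div_div, div_eq_mul_inv _ ((2 : ℚ) ^ k),
        div_eq_mul_inv _ ((2 : ZMod p) ^ k)]
      exact (((Reduces.hBelow 1 hk).pow 2).div_natCast hk).mul (invTwo k)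
    · rw [sum_harmonic_sq_div_mul_two_pow hp5 hκ ha]
      convert (Reduces.ofNat 7).mul hB using 1
      ring
  · rw [sum_Icc_one_eq_sum_range hp0 (by simp)]
    simp only [harmonicOrd_eq_hBelow _ two_pos]
    refine RatModEq.of_const_mul hp5 3 1 (mul24 (Reduces.sum
      (g := fun k => 2 ^ k * hBelow (ZMod p) 2 (k + 1) / (k : ZMod p)) fun k hk => ?_)) ?_
    · rw [Finset.mem_range] at hk
      exact ((two k).mul (Reduces.hBelow 2 hk)).div_natCast hk
    · rw [sum_two_pow_mul_harmonicOrd_two_div hp5 hL hκ ha]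
      convert rhs.sub ((Reduces.ofNat 25).mul hB) using 1
      ring
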